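/- Let $S$ be a complete separable metric space, $\mu$ a Borel measure on $S$ that is finite on bounded Borel sets, and $a,c>0$. Let $\widehat{\mathcal N}_S$ be the space of Borel measures on $S$ that take values in $\{0,1,2,\dots\}$ on bounded Borel sets, with the coarsest topology for which $m\mapsto\int f\,dm$ is continuous for every nonnegative bounded continuous $f$ vanishing outside a bounded set, and with its Borel $\sigma$-algebra; a point process on $S$ is a random element of $\widehat{\mathcal N}_S$. Write $x_{(\beta)}=\Gamma(x+\beta)/\Gamma(x)$ for $x>0$, $\beta\ge 0$, and $x_{(n)}=x(x+1)\cdots(x+n-1)$ for $x\ge 0$ and $n\in\{0,1,2,\dots\}$. For $a,\rho,k>0$, a point process $N$ is a generalized Waring process with parameters $a,\rho,k$ and parameter measure $\mu$ if for all $l$, all pairwise disjoint bounded Borel sets $A_1,\dots,A_l\subseteq S$ and all integers $n_1,\dots,n_l\ge 0$ $$P\{N(A_i)=n_i,\ i=1,\dots,l\}=\frac{\rho_{(k\sum_i\mu(A_i))}\;a_{(\sum_i n_i)}}{(\rho+a)_{(k\sum_i\mu(A_i)+\sum_i n_i)}}\prod_{i=1}^l\frac{(k\mu(A_i))_{(n_i)}}{n_i!}.$$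 It is a negative binomial process with parameters $a,c$ and parameter measure $\mu$ if for all such $l$, $A_i$, $n_i$ $$P\{N(A_i)=n_i,\ i=1,\dots,l\}=\frac{a_{(\sum_i n_i)}\,c^{a}}{(c+\sum_i\mu(A_i))^{a+\sum_i n_i}}\prod_{i=1}^l\frac{\mu(A_i)^{n_i}}{n_i!}$$ (with $0^0=1$). Equivalently, for all such $l$ and $A_i$ and all $z_1,\dots,z_l\in[0,1]$, $E\prod_i z_i^{N(A_i)}=\bigl(c/(c+\sum_i(1-z_i)\mu(A_i))\bigr)^{a}$; in particular $P\{N(A)=0\}=(c/(c+\mu(A)))^a$. Theorem. A negative binomial process with parameters $a,c$ and parameter measure $\mu$ exists. If $(k_n)_{n\ge0}$ is any sequence of positive real numbers with $k_n\to\infty$ (for instance $k_n=n+1$) and, for each $n$, $N_n$ is a generalized Waring process with parameters $a$, $\rho_n=c\,k_n$, $k_n$ and parameter measure $\mu$, then $N_n$ converges weakly (in distribution, as random elements of $\widehat{\mathcal N}_S$) to the negative binomial process with parameters $a,c$ and parameter measure $\mu$. -/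

import Mathlib

open MeasureTheory Filter Topology
open scoped ENNReal NNReal BigOperators

namespace WaringProcess

/-- A measure on a metric space is boundedly finite if it is finite on bounded Borel sets. -/
def BoundedlyFinite {S : Type*} [MetricSpace S] [MeasurableSpace S] (μ : Measure S) : Prop :=
  ∀ B : Set S, MeasurableSet B → Bornology.IsBounded B → μ B < ∞

/-- A boundedly finite, integer-valued Borel measure on a metric space: every bounded Borel set
has a measure in `{0, 1, 2, …}` (in particular a finite one). -/
structure CountingMeasure (S : Type*) [MetricSpace S] [MeasurableSpace S] where
  toMeasure : Measure S
  natValued : ∀ B : Set S, MeasurableSet B → Bornology.IsBounded B → ∃ n : ℕ, toMeasure B = n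

/-- The topology on the space of boundedly finite integer-valued measures: the coarsest one for
which `m ↦ ∫ f dm` is continuous for each nonnegative bounded continuous function `f` that vanishes
outside a bounded set. -/
noncomputable instance {S : Type*} [MetricSpace S] [MeasurableSpace S] : TopologicalSpace (CountingMeasure S) :=
  ⨅ f : {f : BoundedContinuousFunction S ℝ≥0 // Bornology.IsBounded (Function.support f)},
    TopologicalSpace.induced
      (fun m : CountingMeasure S => ∫⁻ x, (f.1 x : ℝ≥0∞) ∂m.toMeasure) inferInstance

/-- The space of boundedly finite integer-valued measures carries its Borel σ-algebra. -/
noncomputable instance {S : Type*} [MetricSpace S] [MeasurableSpace S] : MeasurableSpace (CountingMeasure S) :=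
  borel _

instance {S : Type*} [MetricSpace S] [MeasurableSpace S] : BorelSpace (CountingMeasure S) :=
  ⟨rfl⟩

/-- The ratio `x_(β) = Γ(x + β) / Γ(x)`, used for `x > 0` and real `β ≥ 0`. -/
noncomputable def risingFactorial (x β : ℝ) : ℝ := Real.Gamma (x + β) / Real.Gamma x

/-- Probability function of the multivariate generalized Waring distribution with parameters
`(a; κ₁, …, κ_l; ρ)`, where `a, ρ > 0` and `κ_i ≥ 0`. The factors `(κ_i)_(x_i)` have a natural number
`x_i` as their order and are written as the products `κ (κ + 1) ⋯ (κ + x - 1)`, which equal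
`Γ(κ + x) / Γ(κ)` for `κ > 0` and have the right limiting value at `κ = 0`. -/
noncomputable def waringMass {l : ℕ} (a : ℝ) (κ : Fin l → ℝ) (ρ : ℝ) (x : Fin l → ℕ) : ℝ :=
  risingFactorial ρ (∑ i, κ i) * risingFactorial a (∑ i, (x i : ℝ)) /
      risingFactorial (ρ + a) (∑ i, κ i + ∑ i, (x i : ℝ)) *
    ∏ i, (ascPochhammer ℝ (x i)).eval (κ i) / ((x i).factorial : ℝ)

/-- Probability function of the multivariate negative binomial distribution with parameters
`a, c > 0` and `m₁, …, m_l ≥ 0`; its probability generating function is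
`(c / (c + ∑ i, (1 - z_i) * m_i)) ^ a`. -/
noncomputable def negBinomialMass {l : ℕ} (a c : ℝ) (m : Fin l → ℝ) (x : Fin l → ℕ) : ℝ :=
  risingFactorial a (∑ i, (x i : ℝ)) * c ^ a / (c + ∑ i, m i) ^ (a + ∑ i, (x i : ℝ)) *
    ∏ i, m i ^ (x i) / ((x i).factorial : ℝ)

/-- `N` is a point process (a random element of the space of boundedly finite integer-valued
measures) on the probability space `(Ω, P)`, and for pairwise disjoint bounded Borel sets
`A₁, …, A_l` the vector `(N(A₁), …, N(A_l))` has the probability function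
`p (μ(A₁), …, μ(A_l))`. -/
def IsPointProcessWithFidi {S : Type*} [MetricSpace S] [MeasurableSpace S]
    {Ω : Type*} [MeasurableSpace Ω] (P : Measure Ω) (N : Ω → CountingMeasure S) (μ : Measure S)
    (p : ∀ l : ℕ, (Fin l → ℝ) → (Fin l → ℕ) → ℝ) : Prop :=
  Measurable N ∧
    ∀ (l : ℕ) (A : Fin l → Set S), (∀ i, MeasurableSet (A i)) →
      (∀ i, Bornology.IsBounded (A i)) → Pairwise (fun i j => Disjoint (A i) (A j)) →
      ∀ x : Fin l → ℕ,
        P.real {ω | ∀ i, (N ω).toMeasure (A i) = (x i : ℝ≥0∞)} = p l (fun i => μ.real (A i)) x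

/-- `N` is a generalized Waring process with parameters `a, ρ, k` and parameter measure `μ`. -/
def IsGeneralizedWaringProcess {S : Type*} [MetricSpace S] [MeasurableSpace S]
    {Ω : Type*} [MeasurableSpace Ω] (P : Measure Ω) (N : Ω → CountingMeasure S)
    (a ρ k : ℝ) (μ : Measure S) : Prop :=
  IsPointProcessWithFidi P N μ (fun _ m x => waringMass a (fun i => k * m i) ρ x)

/-- `N` is a negative binomial process with parameters `a, c` and parameter measure `μ`. -/
def IsNegativeBinomialProcess {S : Type*} [MetricSpace S] [MeasurableSpace S]
    {Ω : Type*} [MeasurableSpace Ω] (P : Measure Ω) (N : Ω → CountingMeasure S)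
    (a c : ℝ) (μ : Measure S) : Prop :=
  IsPointProcessWithFidi P N μ (fun _ m x => negBinomialMass a c m x)

end WaringProcess

/-!
The generalized Waring probabilities of the counts of finitely many disjoint bounded sets converge
to the negative binomial ones, because `Γ (y + s) ∼ Γ y * y ^ s` as `y → ∞`
(`tendsto_Gamma_add_div`, `tendsto_waringMass`). Two further facts are needed: such a convergence of
the finite-dimensional probability functions implies weak convergence of the processes, and the
limiting process exists.

**Weak convergence.** Let `V` be a sequence of bounded open sets which forms a basis of the topology
and is cofinal among the bounded sets, and say that two counting measures agree at level `K` if they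
have the same mass on each atom of the ring generated by `V 0, …, V (K - 1)`. If `m' K` agrees with
`m` at level `K` for every `K`, then `m' K` converges to `m` (`tendsto_of_agree`): in a bounded
region, all the mass of the integer-valued measure `m` is carried by finitely many of the `V i` on
which a given test function is nearly constant. Hence each open set `G` of counting measures is the
increasing union of the sets `{m | every m' that agrees with m at level K is in G}`, and each of
these is a countable disjoint union of events prescribing finitely many counts. This gives two
things at once. The Borel σ-algebra is generated by the evaluations
(`measurable_of_measurable_toMeasure`), and Fatou's lemma for the sum over these events yields
`Q G ≤ liminf Q n G` for open `G`, so that the portmanteau theorem applies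
(`tendsto_of_tendsto_countEvent`).

**Existence.** A negative binomial process is a Poisson process with random intensity `Λ • μ`, where
`Λ` has the Gamma distribution with parameters `a, c` (`exists_isNegativeBinomialProcess`). For
constant `Λ`, the Poisson process is the superposition of independent Poisson configurations in the
cells of a countable partition of `S` into bounded sets. The generating function of its counts is
computed cell by cell and identifies them as independent Poisson variables
(`map_count_poissonFamily`), since a probability on `ℕ ^ l` is determined by its generating function
(`measure_ext_of_lintegral_prod_pow_eq`). Integrating products of Poisson probabilities against the
Gamma density gives the negative binomial probabilities (`lintegral_gammaMeasure_poisson`).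
-/

namespace WaringProcess

/-! ### Atoms of bounded open sets and the topology of counting measures -/

section Topology

/-- In a separable metric space there is a sequence of bounded open sets which contains a
neighbourhood basis at every point and a superset of every bounded set. -/
lemma exists_seq_bounded_open_basis (S : Type*) [MetricSpace S]
    [TopologicalSpace.SeparableSpace S] :
    ∃ V : ℕ → Set S, (∀ i, IsOpen (V i)) ∧ (∀ i, Bornology.IsBounded (V i)) ∧
      (∀ B : Set S, Bornology.IsBounded B → ∃ i, B ⊆ V i) ∧
      ∀ x : S, ∀ U ∈ 𝓝 x, ∃ i, x ∈ V i ∧ V i ⊆ U := by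
  obtain ⟨D, hDc, hDd⟩ := TopologicalSpace.exists_countable_dense S
  let F : Set (Set S) := insert ∅ (⋃ s ∈ D, ⋃ q : ℚ, {Metric.ball s (q : ℝ)})
  have hF : F.Countable :=
    (hDc.biUnion fun s _ => Set.countable_iUnion fun q => Set.countable_singleton _).insert _
  obtain ⟨V, hV⟩ := hF.exists_eq_range ⟨∅, Set.mem_insert _ _⟩
  have hmem : ∀ i, V i = ∅ ∨ ∃ s ∈ D, ∃ q : ℚ, V i = Metric.ball s q := by
    intro i
    have : V i ∈ F := hV ▸ Set.mem_range_self i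
    simpa [F, eq_comm] using this
  have hball : ∀ s ∈ D, ∀ q : ℚ, ∃ i, V i = Metric.ball s q := by
    intro s hs q
    have : Metric.ball s (q : ℝ) ∈ F := by
      refine Or.inr ?_
      simp only [Set.mem_iUnion]
      exact ⟨s, hs, q, rfl⟩
    rw [hV] at this
    exact this
  refine ⟨V, fun i => ?_, fun i => ?_, fun B hB => ?_, fun x U hU => ?_⟩
  · rcases hmem i with h | ⟨s, -, q, h⟩ <;> rw [h]
    exacts [isOpen_empty, Metric.isOpen_ball]
  · rcases hmem i with h | ⟨s, -, q, h⟩ <;> rw [h]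
    exacts [Bornology.isBounded_empty, Metric.isBounded_ball]
  · rcases B.eq_empty_or_nonempty with rfl | ⟨x, hx⟩
    · exact ⟨0, Set.empty_subset _⟩
    · obtain ⟨s, hs⟩ := hDd.nonempty_iff.2 ⟨x⟩
      obtain ⟨r, hr⟩ := hB.subset_ball s
      obtain ⟨q, hq⟩ := exists_rat_gt r
      obtain ⟨i, hi⟩ := hball s hs q
      exact ⟨i, hi ▸ hr.trans (Metric.ball_subset_ball hq.le)⟩
  · obtain ⟨r, hr, hrU⟩ := Metric.mem_nhds_iff.1 hU
    obtain ⟨q, hq0, hq⟩ := exists_rat_btwn (half_pos hr)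
    obtain ⟨s, hs, hsx⟩ := hDd.exists_dist_lt x hq0
    obtain ⟨i, hi⟩ := hball s hs q
    refine ⟨i, hi ▸ hsx, hi ▸ (Metric.ball_subset_ball' ?_).trans hrU⟩
    rw [dist_comm]
    linarith

variable {S : Type*}

/-- The atom of the ring generated by `V 0, …, V (K - 1)` with membership pattern `T`: the points
which, among these sets, lie exactly in the `V i` with `i ∈ T`. -/
def atom (V : ℕ → Set S) (K : ℕ) (T : Finset ℕ) : Set S := {x | ∀ i < K, x ∈ V i ↔ i ∈ T}

/-- The nonempty membership patterns for `V 0, …, V (K - 1)`. The empty pattern is left out: its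
atom, the complement of all the `V i`, need not be bounded. -/
def patterns (K : ℕ) : Finset (Finset ℕ) := (Finset.range K).powerset.erase ∅

lemma mem_patterns {K : ℕ} {T : Finset ℕ} :
    T ∈ patterns K ↔ T ≠ ∅ ∧ T ⊆ Finset.range K := by
  simp [patterns]

lemma atom_subset {V : ℕ → Set S} {K : ℕ} {T : Finset ℕ} {i : ℕ} (hi : i < K) (hT : i ∈ T) :
    atom V K T ⊆ V i := fun _ hx => (hx i hi).2 hT

lemma disjoint_atom (V : ℕ → Set S) {K : ℕ} {T T' : Finset ℕ} (hT : T ⊆ Finset.range K)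
    (hT' : T' ⊆ Finset.range K) (h : T ≠ T') : Disjoint (atom V K T) (atom V K T') := by
  refine Set.disjoint_left.2 fun x hx hx' => h ?_
  ext i
  by_cases hi : i < K
  · rw [← hx i hi, ← hx' i hi]
  · exact iff_of_false (fun h => hi (Finset.mem_range.1 (hT h)))
      (fun h => hi (Finset.mem_range.1 (hT' h)))

lemma biUnion_atom (V : ℕ → Set S) {K i : ℕ} (hi : i < K) :
    ⋃ T ∈ (patterns K).filter (i ∈ ·), atom V K T = V i := by
  classical
  ext x
  simp only [Set.mem_iUnion, Finset.mem_filter, exists_prop]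
  constructor
  · rintro ⟨T, ⟨-, hT⟩, hx⟩
    exact atom_subset hi hT hx
  · intro hx
    refine ⟨(Finset.range K).filter (x ∈ V ·), ⟨mem_patterns.2 ⟨?_, Finset.filter_subset _ _⟩, ?_⟩,
      ?_⟩
    · exact Finset.ne_empty_of_mem (a := i) (by simp [hi, hx])
    · simp [hi, hx]
    · intro j hj
      simp [hj]

lemma pairwiseDisjoint_atom (V : ℕ → Set S) (K i : ℕ) :
    (((patterns K).filter (i ∈ ·) : Finset (Finset ℕ)) : Set (Finset ℕ)).PairwiseDisjoint
      (atom V K) := by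
  intro T hT T' hT' h
  simp only [Finset.coe_filter, Set.mem_ofPred_eq, mem_patterns] at hT hT'
  exact disjoint_atom V hT.1.2 hT'.1.2 h

lemma measurableSet_atom [MeasurableSpace S] {V : ℕ → Set S} (hV : ∀ i, MeasurableSet (V i))
    (K : ℕ) (T : Finset ℕ) :
    MeasurableSet (atom V K T) := by
  have : atom V K T = ⋂ i ∈ Finset.range K, if i ∈ T then V i else (V i)ᶜ := by
    ext x
    simp only [atom, Set.mem_ofPred_eq, Set.mem_iInter, Finset.mem_range]
    refine forall₂_congr fun i _ => ?_
    split_ifs with h <;> simp [h]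
  rw [this]
  refine Finset.measurableSet_biInter _ fun i _ => ?_
  split_ifs
  exacts [hV i, (hV i).compl]

lemma isBounded_atom [MetricSpace S] {V : ℕ → Set S} (hb : ∀ i, Bornology.IsBounded (V i))
    {K : ℕ} {T : Finset ℕ} (hT : T ∈ patterns K) : Bornology.IsBounded (atom V K T) := by
  obtain ⟨h0, hK⟩ := mem_patterns.1 hT
  obtain ⟨i, hi⟩ := Finset.nonempty_iff_ne_empty.2 h0
  exact (hb i).subset (atom_subset (Finset.mem_range.1 (hK hi)) hi)

variable [MetricSpace S] [MeasurableSpace S]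

/-- Two counting measures agree at level `K` if they have the same mass on every bounded atom
generated by `V 0, …, V (K - 1)`. -/
def Agree (V : ℕ → Set S) (K : ℕ) (m m' : CountingMeasure S) : Prop :=
  ∀ T ∈ patterns K, m.toMeasure (atom V K T) = m'.toMeasure (atom V K T)

lemma Agree.symm {V : ℕ → Set S} {K : ℕ} {m m' : CountingMeasure S} (h : Agree V K m m') :
    Agree V K m' m := fun T hT => (h T hT).symm

/-- Each atom of level `K` splits into at most two atoms of level `K + 1`, so agreement at a finer
level implies agreement at a coarser one. -/
lemma Agree.of_succ {V : ℕ → Set S} (hV : ∀ i, MeasurableSet (V i)) {K : ℕ}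
    {m m' : CountingMeasure S} (h : Agree V (K + 1) m m') : Agree V K m m' := by
  intro T hT
  obtain ⟨h0, hTK⟩ := mem_patterns.1 hT
  have hKT : K ∉ T := fun h => by simpa using hTK h
  have h1 : T ∈ patterns (K + 1) :=
    mem_patterns.2 ⟨h0, hTK.trans (Finset.range_mono (Nat.le_succ K))⟩
  have h2 : insert K T ∈ patterns (K + 1) :=
    mem_patterns.2 ⟨Finset.insert_ne_empty _ _, Finset.insert_subset (by simp)
      (mem_patterns.1 h1).2⟩
  have hsplit : atom V K T = atom V (K + 1) T ∪ atom V (K + 1) (insert K T) := by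
    ext x
    simp only [atom, Set.mem_union, Set.mem_ofPred_eq, Nat.lt_succ_iff_lt_or_eq, or_imp,
      forall_and, forall_eq, Finset.mem_insert, hKT, iff_false, true_or, iff_true]
    constructor
    · intro hx
      by_cases hxK : x ∈ V K
      · refine Or.inr ⟨fun i hi => ?_, hxK⟩
        rw [hx i hi]
        simp [hi.ne]
      · exact Or.inl ⟨hx, hxK⟩
    · rintro (⟨hx, -⟩ | ⟨hx, -⟩) i hi
      · exact hx i hi
      · rw [hx i hi]
        simp [hi.ne]
  have hd := disjoint_atom V (mem_patterns.1 h1).2 (mem_patterns.1 h2).2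
    (fun h => hKT (h ▸ Finset.mem_insert_self K T))
  rw [hsplit, measure_union hd (measurableSet_atom hV _ _),
    measure_union hd (measurableSet_atom hV _ _), h _ h1, h _ h2]

lemma Agree.mono {V : ℕ → Set S} (hV : ∀ i, MeasurableSet (V i)) {K L : ℕ} (hKL : K ≤ L)
    {m m' : CountingMeasure S} (h : Agree V L m m') : Agree V K m m' := by
  induction L, hKL using Nat.le_induction with
  | base => exact h
  | succ L _ ih => exact ih (h.of_succ hV)

/-- If `f` vanishes off `V i₀` and oscillates by at most `ε` on each set `V i`, `i ∈ I`, and if the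
part of `V i₀` not covered by these sets carries no mass, then the integrals of `f` against two
measures which agree on the atoms differ by at most `ε` times the mass of `V i₀`. -/
lemma Agree.lintegral_le {V : ℕ → Set S} (hV : ∀ i, MeasurableSet (V i)) {K i₀ : ℕ} (hi₀ : i₀ < K)
    {m m' : CountingMeasure S} (h : Agree V K m m') {f : S → ℝ≥0∞}
    (hf : Function.support f ⊆ V i₀) {ε : ℝ≥0∞} {I : Set ℕ}
    (hI : ∀ i ∈ I, ∀ x ∈ V i, ∀ y ∈ V i, f x ≤ f y + ε)
    (hnull : ∀ T ∈ patterns K, i₀ ∈ T → (∀ i ∈ T, i ∉ I) → m.toMeasure (atom V K T) = 0) :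
    ∫⁻ x, f x ∂m.toMeasure ≤ ∫⁻ x, f x ∂m'.toMeasure + ε * m'.toMeasure (V i₀) := by
  rw [← setLIntegral_eq_of_support_subset (μ := m.toMeasure) hf,
    ← setLIntegral_eq_of_support_subset (μ := m'.toMeasure) hf, ← biUnion_atom V hi₀,
    lintegral_biUnion_finset (pairwiseDisjoint_atom V K i₀)
      (fun T _ => measurableSet_atom hV K T),
    lintegral_biUnion_finset (pairwiseDisjoint_atom V K i₀) (fun T _ => measurableSet_atom hV K T),
    measure_biUnion_finset (pairwiseDisjoint_atom V K i₀) (fun T _ => measurableSet_atom hV K T),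
    Finset.mul_sum, ← Finset.sum_add_distrib]
  refine Finset.sum_le_sum fun T hT => ?_
  simp only [Finset.mem_filter] at hT
  have hTm := h T hT.1
  have hmeas := measurableSet_atom hV K T
  by_cases hTI : ∃ i ∈ T, i ∈ I
  · obtain ⟨i, hiT, hiI⟩ := hTI
    have hiK : i < K := Finset.mem_range.1 ((mem_patterns.1 hT.1).2 hiT)
    have hsub := atom_subset (V := V) hiK hiT
    -- Compare both integrals with the infimum of `f` over the atom.
    have h1 : ∫⁻ x in atom V K T, f x ∂m.toMeasure
        ≤ ∫⁻ _ in atom V K T, ((⨅ y ∈ atom V K T, f y) + ε) ∂m.toMeasure := by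
      refine setLIntegral_mono measurable_const fun x hx => ?_
      rw [← tsub_le_iff_right]
      exact le_iInf₂ fun y hy => tsub_le_iff_right.2 (hI i hiI x (hsub hx) y (hsub hy))
    have h2 : ∫⁻ _ in atom V K T, (⨅ y ∈ atom V K T, f y) ∂m'.toMeasure
        ≤ ∫⁻ x in atom V K T, f x ∂m'.toMeasure :=
      setLIntegral_mono' hmeas fun x hx => iInf₂_le x hx
    rw [setLIntegral_const] at h1 h2
    refine h1.trans ?_
    rw [hTm, add_mul]
    gcongr
  · have h0 := hnull T hT.1 hT.2 fun i hi hiI => hTI ⟨i, hi, hiI⟩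
    rw [setLIntegral_measure_zero _ _ h0]
    exact zero_le

lemma CountingMeasure.measure_lt_top (m : CountingMeasure S) {B : Set S} (hB : MeasurableSet B)
    (hb : Bornology.IsBounded B) : m.toMeasure B < ∞ := by
  obtain ⟨n, hn⟩ := m.natValued B hB hb
  rw [hn]
  exact ENNReal.natCast_lt_top n

variable [BorelSpace S]

/-- Counting measures which agree with `m` on finer and finer atoms converge to `m`. Since `m` is
integer valued, finitely many small sets carry all of its mass in a bounded region. -/
lemma tendsto_of_agree {V : ℕ → Set S} (hVo : ∀ i, IsOpen (V i))
    (hVb : ∀ i, Bornology.IsBounded (V i))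
    (hVc : ∀ B : Set S, Bornology.IsBounded B → ∃ i, B ⊆ V i)
    (hVn : ∀ x : S, ∀ U ∈ 𝓝 x, ∃ i, x ∈ V i ∧ V i ⊆ U)
    {m : CountingMeasure S} {m' : ℕ → CountingMeasure S} (h : ∀ K, Agree V K m (m' K)) :
    Tendsto m' atTop (𝓝 m) := by
  have hV : ∀ i, MeasurableSet (V i) := fun i => (hVo i).measurableSet
  rw [nhds_iInf, tendsto_iInf]
  rintro ⟨f, hf⟩
  rw [nhds_induced, tendsto_comap_iff]
  obtain ⟨i₀, hi₀⟩ := hVc _ hf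
  have hsupp : Function.support (fun x => (f x : ℝ≥0∞)) ⊆ V i₀ := fun x hx =>
    hi₀ (by simpa using hx)
  have hB := m.measure_lt_top (hV i₀) (hVb i₀)
  have hfin : ∫⁻ x, (f x : ℝ≥0∞) ∂m.toMeasure ≠ ∞ := by
    rw [← setLIntegral_eq_of_support_subset hsupp]
    refine ((setLIntegral_mono (g := fun _ => (nndist f 0 : ℝ≥0∞)) measurable_const
      fun x _ => ?_).trans_lt ?_).ne
    · have := f.dist_coe_le_dist (g := 0) x
      have h2 : (f x : ℝ) ≤ dist f 0 := by simpa [NNReal.dist_eq] using this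
      exact_mod_cast h2
    · rw [setLIntegral_const]
      exact ENNReal.mul_lt_top ENNReal.coe_lt_top hB
  refine (ENNReal.tendsto_nhds hfin).2 fun δ hδ => ?_
  obtain ⟨ε, hε0, hε⟩ : ∃ ε : ℝ≥0, 0 < ε ∧ (ε : ℝ≥0∞) * m.toMeasure (V i₀) < δ := by
    obtain ⟨ε, hε0, hε⟩ := ENNReal.exists_nnreal_pos_mul_lt hB.ne hδ.ne'
    exact ⟨ε, hε0, hε⟩
  let I : Set ℕ := {i | ∀ x ∈ V i, ∀ y ∈ V i, (f x : ℝ≥0∞) ≤ f y + ε}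
  have hcover : ∀ x, ∃ i ∈ I, x ∈ V i := by
    intro x
    have hU : {y | dist (f y) (f x) < ε / 2} ∈ 𝓝 x :=
      f.continuous.continuousAt (Metric.ball_mem_nhds (f x) (by positivity))
    obtain ⟨i, hxi, hiU⟩ := hVn x _ hU
    refine ⟨i, fun y hy z hz => ?_, hxi⟩
    have h1 : dist (f y) (f x) < ε / 2 := hiU hy
    have h2 : dist (f z) (f x) < ε / 2 := hiU hz
    rw [NNReal.dist_eq, abs_lt] at h1 h2
    have h3 : (f y : ℝ) ≤ f z + ε := by linarith
    exact_mod_cast h3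
  -- The part of `V i₀` not covered by finitely many of the small sets eventually has mass zero.
  let W : ℕ → Set S := fun K => V i₀ \ ⋃ i ∈ {i ∈ I | i < K}, V i
  have hWm : ∀ K, MeasurableSet (W K) := fun K =>
    (hV i₀).diff (MeasurableSet.biUnion (Set.to_countable _) fun i _ => hV i)
  have hWanti : Antitone W := by
    intro K L hKL x hx
    refine ⟨hx.1, fun h' => hx.2 ?_⟩
    simp only [Set.mem_iUnion] at h' ⊢
    obtain ⟨i, ⟨hiI, hi⟩, hxi⟩ := h'
    exact ⟨i, ⟨hiI, hi.trans_le hKL⟩, hxi⟩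
  have hWlim : Tendsto (m.toMeasure ∘ W) atTop (𝓝 0) := by
    have hempty : ⋂ K, W K = ∅ := by
      refine Set.eq_empty_of_forall_notMem fun x hx => ?_
      obtain ⟨i, hiI, hxi⟩ := hcover x
      refine (Set.mem_iInter.1 hx (i + 1)).2 ?_
      simp only [Set.mem_iUnion]
      exact ⟨i, ⟨hiI, Nat.lt_succ_self i⟩, hxi⟩
    have := tendsto_measure_iInter_atTop (μ := m.toMeasure) (fun K => (hWm K).nullMeasurableSet)
      hWanti ⟨0, ((measure_mono Set.sdiff_subset).trans_lt hB).ne⟩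
    rwa [hempty, measure_empty] at this
  have hW0 : ∀ᶠ K in atTop, m.toMeasure (W K) = 0 := by
    filter_upwards [hWlim.eventually (gt_mem_nhds one_pos)] with K hK
    obtain ⟨n, hn⟩ := m.natValued _ (hWm K) ((hVb i₀).subset Set.sdiff_subset)
    have hK' : m.toMeasure (W K) < 1 := hK
    rw [hn] at hK' ⊢
    have : n < 1 := by exact_mod_cast hK'
    simp [Nat.lt_one_iff.1 this]
  filter_upwards [hW0, eventually_gt_atTop i₀] with K hK hiK
  have hBeq : (m' K).toMeasure (V i₀) = m.toMeasure (V i₀) := by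
    rw [← biUnion_atom V hiK, measure_biUnion_finset (pairwiseDisjoint_atom V K i₀)
      (fun T _ => measurableSet_atom hV K T), measure_biUnion_finset (pairwiseDisjoint_atom V K i₀)
      (fun T _ => measurableSet_atom hV K T)]
    exact Finset.sum_congr rfl fun T hT => (h K T (Finset.mem_filter.1 hT).1).symm
  have hnull : ∀ T ∈ patterns K, i₀ ∈ T → (∀ i ∈ T, i ∉ I) → m.toMeasure (atom V K T) = 0 := by
    intro T hT hiT hTI
    refine measure_mono_null (t := W K) (fun x hx => ⟨atom_subset hiK hiT hx, ?_⟩) hK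
    simp only [Set.mem_iUnion, not_exists]
    rintro i ⟨hiI, hi⟩ hxi
    exact hTI i ((hx i hi).1 hxi) hiI
  have h1 := (h K).lintegral_le hV hiK hsupp (I := I) (fun i hi => hi) hnull
  have h2 := (h K).symm.lintegral_le hV hiK hsupp (I := I) (fun i hi => hi)
    fun T hT hiT hTI => (h K T hT).symm.trans (hnull T hT hiT hTI)
  rw [hBeq] at h1
  exact ⟨tsub_le_iff_right.2 (h1.trans (by gcongr; rfl)), h2.trans (by gcongr)⟩

/-- Every open set of counting measures is the union of the increasing sequence of its subsets
saturated for agreement at level `K`, which depend on finitely many counts only. -/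
lemma isOpen_eq_iUnion_saturated {V : ℕ → Set S} (hVo : ∀ i, IsOpen (V i))
    (hVb : ∀ i, Bornology.IsBounded (V i))
    (hVc : ∀ B : Set S, Bornology.IsBounded B → ∃ i, B ⊆ V i)
    (hVn : ∀ x : S, ∀ U ∈ 𝓝 x, ∃ i, x ∈ V i ∧ V i ⊆ U)
    {G : Set (CountingMeasure S)} (hG : IsOpen G) :
    G = ⋃ K, {m | ∀ m', Agree V K m m' → m' ∈ G} := by
  ext m
  simp only [Set.mem_iUnion, Set.mem_ofPred_eq]
  refine ⟨fun hm => ?_, fun ⟨K, hK⟩ => hK m fun _ _ => rfl⟩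
  by_contra! hcon
  choose m' hm' hm'G using hcon
  obtain ⟨K, hK⟩ := ((tendsto_of_agree hVo hVb hVc hVn hm').eventually (hG.mem_nhds hm)).exists
  exact hm'G K hK

end Topology

/-! ### Measurability of evaluations and weak convergence -/

section Convergence

variable {S : Type*} [MetricSpace S] [MeasurableSpace S]

/-- The event that the sets `A i` have the masses `x i`. The family may have any index type, so
that it can be indexed by the membership patterns of atoms. -/
def countEvent {ι : Type*} (A : ι → Set S) (x : ι → ℕ) : Set (CountingMeasure S) :=
  {m | ∀ i, m.toMeasure (A i) = x i}

lemma pairwise_disjoint_countEvent {ι : Type*} (A : ι → Set S) :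
    Pairwise (Function.onFun Disjoint (countEvent A)) := by
  intro x y hxy
  refine Set.disjoint_left.2 fun m hx hy => hxy (funext fun i => ?_)
  exact_mod_cast (hx i).symm.trans (hy i)

/-- A set of counting measures saturated for agreement at level `K` is a union of events that
prescribe the counts of the atoms of level `K`. -/
lemma saturated_eq_biUnion_countEvent {V : ℕ → Set S} (hV : ∀ i, MeasurableSet (V i))
    (hVb : ∀ i, Bornology.IsBounded (V i)) (G : Set (CountingMeasure S)) (K : ℕ) :
    ∃ M : Set (patterns K → ℕ), {m | ∀ m', Agree V K m m' → m' ∈ G} =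
      ⋃ x ∈ M, countEvent (fun T : patterns K => atom V K T) x := by
  refine ⟨{x | ∃ m, (∀ m', Agree V K m m' → m' ∈ G) ∧
    m ∈ countEvent (fun T : patterns K => atom V K T) x}, ?_⟩
  ext m
  simp only [Set.mem_iUnion, Set.mem_ofPred_eq, exists_prop]
  constructor
  · intro hm
    choose x hx using fun T : patterns K => m.natValued (atom V K T) (measurableSet_atom hV K T)
      (isBounded_atom hVb T.2)
    exact ⟨x, ⟨m, hm, hx⟩, hx⟩
  · rintro ⟨x, ⟨m₀, hm₀, hx₀⟩, hx⟩ m' hm'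
    exact hm₀ m' fun T hT => (hx₀ ⟨T, hT⟩).trans ((hx ⟨T, hT⟩).symm.trans (hm' T hT))

lemma measurable_lintegral_toMeasure (f : BoundedContinuousFunction S ℝ≥0)
    (hf : Bornology.IsBounded (Function.support f)) :
    Measurable fun m : CountingMeasure S => ∫⁻ x, (f x : ℝ≥0∞) ∂m.toMeasure := by
  have : Continuous fun m : CountingMeasure S => ∫⁻ x, (f x : ℝ≥0∞) ∂m.toMeasure :=
    continuous_iInf_dom (i := (⟨f, hf⟩ :
      {f : BoundedContinuousFunction S ℝ≥0 // Bornology.IsBounded (Function.support f)}))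
      continuous_induced_dom
  exact this.measurable

variable [BorelSpace S]

lemma measurable_toMeasure_isClosed {C : Set S} (hC : IsClosed C) (hb : Bornology.IsBounded C) :
    Measurable fun m : CountingMeasure S => m.toMeasure C := by
  have hδ : ∀ n : ℕ, (0 : ℝ) < 1 / ((n : ℝ) + 1) := fun n => Nat.one_div_pos_of_nat
  have hsupp : ∀ n, Function.support (thickenedIndicator (hδ n) C) ⊆ Metric.thickening 1 C := by
    intro n x hx
    by_contra hx'
    refine hx (thickenedIndicator_zero (hδ n) C fun h => hx' (Metric.thickening_mono ?_ C h))
    exact (div_le_one (by positivity)).2 (by simp)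
  have hUb : Bornology.IsBounded (Metric.thickening 1 C) := hb.thickening
  refine measurable_of_tendsto_metrizable (fun n => measurable_lintegral_toMeasure
    (thickenedIndicator (hδ n) C) (hUb.subset (hsupp n))) (tendsto_pi_nhds.2 fun m => ?_)
  have : IsFiniteMeasure (m.toMeasure.restrict (Metric.thickening 1 C)) :=
    ⟨by simpa using m.measure_lt_top Metric.isOpen_thickening.measurableSet hUb⟩
  have hlim := tendsto_lintegral_thickenedIndicator_of_isClosed
    (m.toMeasure.restrict (Metric.thickening 1 C)) hC hδ tendsto_one_div_add_atTop_nhds_zero_nat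
  rw [Measure.restrict_apply hC.measurableSet,
    Set.inter_eq_self_of_subset_left (Metric.self_subset_thickening one_pos C)] at hlim
  refine hlim.congr fun n => setLIntegral_eq_of_support_subset fun x hx => hsupp n ?_
  simpa using hx

/-- The evaluations at bounded Borel sets are measurable for the Borel σ-algebra. -/
lemma measurable_toMeasure {A : Set S} (hA : MeasurableSet A) (hb : Bornology.IsBounded A) :
    Measurable fun m : CountingMeasure S => m.toMeasure A := by
  rcases A.eq_empty_or_nonempty with rfl | ⟨x, -⟩
  · simp
  obtain ⟨r, hr⟩ := hb.subset_closedBall x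
  have hB := Metric.isBounded_closedBall (x := x) (r := r)
  have hBc := Metric.isClosed_closedBall (x := x) (ε := r)
  have hfin : ∀ m : CountingMeasure S,
      IsFiniteMeasure (m.toMeasure.restrict (Metric.closedBall x r)) := fun m =>
    ⟨by simpa using m.measure_lt_top hBc.measurableSet hB⟩
  have hmeas : Measurable fun m : CountingMeasure S =>
      m.toMeasure.restrict (Metric.closedBall x r) := by
    refine Measurable.measure_of_isPiSystem
      (‹BorelSpace S›.measurable_eq.trans borel_eq_generateFrom_isClosed) isPiSystem_isClosed
      (fun C hC => ?_) ?_
    · have hC' : IsClosed C := hC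
      simp_rw [Measure.restrict_apply hC'.measurableSet]
      exact measurable_toMeasure_isClosed (hC'.inter hBc) (hB.subset Set.inter_subset_right)
    · simp_rw [Measure.restrict_apply MeasurableSet.univ, Set.univ_inter]
      exact measurable_toMeasure_isClosed hBc hB
  have h := (Measure.measurable_coe hA).comp hmeas
  have heq : (fun m : CountingMeasure S => m.toMeasure A) =
      (fun ν : Measure S => ν A) ∘ fun m => m.toMeasure.restrict (Metric.closedBall x r) := by
    ext m
    simp [Measure.restrict_apply hA, Set.inter_eq_self_of_subset_left hr]
  rwa [heq]

lemma measurableSet_countEvent {ι : Type*} [Countable ι] {A : ι → Set S}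
    (hA : ∀ i, MeasurableSet (A i)) (hb : ∀ i, Bornology.IsBounded (A i)) (x : ι → ℕ) :
    MeasurableSet (countEvent A x) := by
  have : countEvent A x =
      ⋂ i, (fun m : CountingMeasure S => m.toMeasure (A i)) ⁻¹' {(x i : ℝ≥0∞)} := by
    ext m
    simp [countEvent]
  rw [this]
  exact .iInter fun i => measurable_toMeasure (hA i) (hb i) (measurableSet_singleton _)

variable [TopologicalSpace.SeparableSpace S]

/-- The Borel σ-algebra on the space of counting measures is generated by the evaluations at
bounded Borel sets. -/
lemma measurable_of_measurable_toMeasure {Ω : Type*} [MeasurableSpace Ω]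
    {Φ : Ω → CountingMeasure S}
    (hΦ : ∀ A, MeasurableSet A → Bornology.IsBounded A → Measurable fun ω => (Φ ω).toMeasure A) :
    Measurable Φ := by
  obtain ⟨V, hVo, hVb, hVc, hVn⟩ := exists_seq_bounded_open_basis S
  have hV : ∀ i, MeasurableSet (V i) := fun i => (hVo i).measurableSet
  refine measurable_of_isOpen fun G hG => ?_
  rw [isOpen_eq_iUnion_saturated hVo hVb hVc hVn hG, Set.preimage_iUnion]
  refine .iUnion fun K => ?_
  obtain ⟨M, hM⟩ := saturated_eq_biUnion_countEvent hV hVb G K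
  rw [hM, Set.preimage_iUnion₂]
  refine .biUnion (Set.to_countable M) fun x _ => ?_
  have : Φ ⁻¹' countEvent (fun T : patterns K => atom V K T) x =
      ⋂ T : patterns K, (fun ω => (Φ ω).toMeasure (atom V K T)) ⁻¹' {(x T : ℝ≥0∞)} := by
    ext ω
    simp [countEvent]
  rw [this]
  exact .iInter fun T => hΦ _ (measurableSet_atom hV K T) (isBounded_atom hVb T.2)
    (measurableSet_singleton _)

/-- Laws on the space of counting measures converge weakly if the probability functions of the
counts of finitely many disjoint bounded Borel sets converge pointwise. -/
lemma tendsto_of_tendsto_countEvent {Q : ℕ → ProbabilityMeasure (CountingMeasure S)}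
    {Q' : ProbabilityMeasure (CountingMeasure S)}
    (h : ∀ (l : ℕ) (A : Fin l → Set S), (∀ i, MeasurableSet (A i)) →
      (∀ i, Bornology.IsBounded (A i)) → Pairwise (fun i j => Disjoint (A i) (A j)) →
      ∀ x : Fin l → ℕ, Tendsto (fun n => (Q n : Measure (CountingMeasure S)) (countEvent A x)) atTop
        (𝓝 ((Q' : Measure (CountingMeasure S)) (countEvent A x)))) :
    Tendsto Q atTop (𝓝 Q') := by
  obtain ⟨V, hVo, hVb, hVc, hVn⟩ := exists_seq_bounded_open_basis S
  have hV : ∀ i, MeasurableSet (V i) := fun i => (hVo i).measurableSet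
  refine tendsto_of_forall_isOpen_le_liminf_nat' fun G hG => ?_
  have hGU := isOpen_eq_iUnion_saturated hVo hVb hVc hVn hG
  have hmono : Monotone fun K => {m | ∀ m', Agree V K m m' → m' ∈ G} :=
    fun K L hKL m hm m' hm' => hm m' (hm'.mono hV hKL)
  conv_lhs => rw [hGU]
  rw [hmono.measure_iUnion]
  refine iSup_le fun K => ?_
  have hsub : {m | ∀ m', Agree V K m m' → m' ∈ G} ⊆ G := fun m hm => hm m fun _ _ => rfl
  refine le_trans ?_ (liminf_le_liminf (Eventually.of_forall fun n => measure_mono hsub))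
  obtain ⟨M, hM⟩ := saturated_eq_biUnion_countEvent hV hVb G K
  rw [hM]
  have hsum : ∀ R : Measure (CountingMeasure S),
      R (⋃ x ∈ M, countEvent (fun T : patterns K => atom V K T) x) =
        ∫⁻ x : M, R (countEvent (fun T : patterns K => atom V K T) x) ∂Measure.count := by
    intro R
    rw [measure_biUnion (Set.to_countable M)
      ((pairwise_disjoint_countEvent _).set_pairwise M)
      fun x _ => measurableSet_countEvent (fun T : patterns K => measurableSet_atom hV K T)
        (fun T : patterns K => isBounded_atom hVb T.2) x, lintegral_count]
  simp_rw [hsum]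
  refine le_trans (lintegral_mono fun x => ?_)
    (lintegral_liminf_le fun n => measurable_of_countable _)
  let e := (Fintype.equivFin (patterns K)).symm
  have hreindex : countEvent (fun T : patterns K => atom V K T) x.1 =
      countEvent (fun i => atom V K (e i)) (fun i => x.1 (e i)) := by
    ext m
    exact e.forall_congr_right.symm
  rw [hreindex]
  refine (h _ _ (fun i => measurableSet_atom hV K _) (fun i => isBounded_atom hVb (e i).2)
    (fun i j hij => disjoint_atom V (mem_patterns.1 (e i).2).2 (mem_patterns.1 (e j).2).2
      fun hT => hij (e.injective (Subtype.ext hT))) _).liminf_eq.ge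

end Convergence

/-! ### Asymptotics of the Gamma function and of the Waring probabilities -/

section GammaAsymptotics

/-- Log-convexity of the Gamma function gives Wendel's bounds
`(y / (y + s)) ^ (1 - s) ≤ Γ (y + s) / (y ^ s * Γ y) ≤ 1`, hence the limit, for `0 < s < 1`. -/
lemma tendsto_Gamma_add_div_of_lt_one {s : ℝ} (hs : 0 < s) (hs1 : s < 1) :
    Tendsto (fun y => Real.Gamma (y + s) / (Real.Gamma y * y ^ s)) atTop (𝓝 1) := by
  have hupper : ∀ y : ℝ, 0 < y → Real.Gamma (y + s) / (Real.Gamma y * y ^ s) ≤ 1 := by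
    intro y hy
    have hG := Real.Gamma_pos_of_pos hy
    have := Real.Gamma_mul_add_mul_le_rpow_Gamma_mul_rpow_Gamma hy (t := y + 1) (by linarith)
      (sub_pos.2 hs1) hs (by ring)
    rw [show (1 - s) * y + s * (y + 1) = y + s by ring, Real.Gamma_add_one hy.ne',
      Real.mul_rpow hy.le hG.le] at this
    have h2 : Real.Gamma y ^ (1 - s) * Real.Gamma y ^ s = Real.Gamma y := by
      rw [← Real.rpow_add hG]; simp
    rw [div_le_one (by positivity)]
    calc _ ≤ _ := this
      _ = (Real.Gamma y ^ (1 - s) * Real.Gamma y ^ s) * y ^ s := by ring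
      _ = _ := by rw [h2]
  have hlower : ∀ y : ℝ, 0 < y →
      (y / (y + s)) ^ (1 - s) ≤ Real.Gamma (y + s) / (Real.Gamma y * y ^ s) := by
    intro y hy
    have hys : 0 < y + s := by linarith
    have hG := Real.Gamma_pos_of_pos hys
    have hGy := Real.Gamma_pos_of_pos hy
    have := Real.Gamma_mul_add_mul_le_rpow_Gamma_mul_rpow_Gamma hys (t := y + s + 1) (by linarith)
      hs (sub_pos.2 hs1) (by ring)
    rw [show s * (y + s) + (1 - s) * (y + s + 1) = y + 1 by ring, Real.Gamma_add_one hy.ne',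
      Real.Gamma_add_one hys.ne', Real.mul_rpow hys.le hG.le] at this
    have h2 : Real.Gamma (y + s) ^ s * Real.Gamma (y + s) ^ (1 - s) = Real.Gamma (y + s) := by
      rw [← Real.rpow_add hG]; simp
    have h3 : y ^ (1 - s) * y ^ s = y := by rw [← Real.rpow_add hy]; simp
    rw [le_div_iff₀ (by positivity), Real.div_rpow hy.le hys.le, div_mul_eq_mul_div,
      div_le_iff₀ (by positivity)]
    calc y ^ (1 - s) * (Real.Gamma y * y ^ s) = (y ^ (1 - s) * y ^ s) * Real.Gamma y := by ring
      _ = y * Real.Gamma y := by rw [h3]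
      _ ≤ _ := this
      _ = (Real.Gamma (y + s) ^ s * Real.Gamma (y + s) ^ (1 - s)) * (y + s) ^ (1 - s) := by ring
      _ = _ := by rw [h2]
  have hlim : Tendsto (fun y : ℝ => (y / (y + s)) ^ (1 - s)) atTop (𝓝 1) := by
    have h1 : Tendsto (fun y : ℝ => y / (y + s)) atTop (𝓝 1) := by
      have h2 : Tendsto (fun y : ℝ => 1 - s / (y + s)) atTop (𝓝 (1 - 0)) :=
        tendsto_const_nhds.sub
          (tendsto_const_nhds.div_atTop (tendsto_atTop_add_const_right _ _ tendsto_id))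
      rw [sub_zero] at h2
      refine h2.congr' ?_
      filter_upwards [eventually_gt_atTop 0] with y hy
      have : y + s ≠ 0 := by positivity
      field_simp
      ring
    simpa using h1.rpow_const (p := 1 - s) (Or.inl one_ne_zero)
  refine tendsto_of_tendsto_of_tendsto_of_le_of_le' hlim tendsto_const_nhds ?_ ?_
  · filter_upwards [eventually_gt_atTop 0] with y hy using hlower y hy
  · filter_upwards [eventually_gt_atTop 0] with y hy using hupper y hy

/-- `Γ (y + s) ∼ Γ y * y ^ s` as `y → ∞`, for every fixed `s ≥ 0`. -/
lemma tendsto_Gamma_add_div {s : ℝ} (hs : 0 ≤ s) :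
    Tendsto (fun y => Real.Gamma (y + s) / (Real.Gamma y * y ^ s)) atTop (𝓝 1) := by
  have key : ∀ n : ℕ, ∀ t : ℝ, 0 ≤ t → t < 1 →
      Tendsto (fun y => Real.Gamma (y + (t + n)) / (Real.Gamma y * y ^ (t + n))) atTop (𝓝 1) := by
    intro n
    induction n with
    | zero =>
      intro t ht ht1
      rcases ht.eq_or_lt with rfl | ht
      · refine tendsto_const_nhds.congr' ?_
        filter_upwards [eventually_gt_atTop 0] with y hy
        simp [(Real.Gamma_pos_of_pos hy).ne']
      · simpa using tendsto_Gamma_add_div_of_lt_one ht ht1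
    | succ n ih =>
      intro t ht ht1
      have h1 : Tendsto (fun y : ℝ => 1 + (t + n) / y) atTop (𝓝 (1 + 0)) :=
        tendsto_const_nhds.add (tendsto_const_nhds.div_atTop tendsto_id)
      have h2 := (ih t ht ht1).mul h1
      rw [add_zero, mul_one] at h2
      refine h2.congr' ?_
      filter_upwards [eventually_gt_atTop 0] with y hy
      have hyt : y + (t + n) ≠ 0 := by positivity
      have hG := (Real.Gamma_pos_of_pos hy).ne'
      have hp : y ^ (t + n) ≠ 0 := (Real.rpow_pos_of_pos hy _).ne'
      rw [show y + (t + ((n + 1 : ℕ) : ℝ)) = (y + (t + n)) + 1 by push_cast; ring,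
        show t + ((n + 1 : ℕ) : ℝ) = (t + n) + 1 by push_cast; ring,
        Real.Gamma_add_one hyt, Real.rpow_add_one hy.ne']
      field_simp
  have := key ⌊s⌋₊ (s - ⌊s⌋₊) (sub_nonneg.2 (Nat.floor_le hs))
    (by linarith [Nat.lt_floor_add_one s])
  simpa using this

lemma tendsto_ascPochhammer_eval_mul_div_pow (m : ℝ) (n : ℕ) :
    Tendsto (fun k : ℝ => (ascPochhammer ℝ n).eval (k * m) / k ^ n) atTop (𝓝 (m ^ n)) := by
  induction n with
  | zero => simp
  | succ n ih =>
    have h1 : Tendsto (fun k : ℝ => m + n / k) atTop (𝓝 (m + 0)) :=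
      tendsto_const_nhds.add (tendsto_const_nhds.div_atTop tendsto_id)
    have h2 := ih.mul h1
    rw [add_zero, ← pow_succ] at h2
    refine h2.congr' ?_
    filter_upwards [eventually_gt_atTop 0] with k hk
    rw [ascPochhammer_succ_eval]
    field_simp
    ring

/-- As `k → ∞`, the multivariate generalized Waring probabilities with parameters `(a; k m; c k)`
converge to the multivariate negative binomial ones. -/
lemma tendsto_waringMass {l : ℕ} {a c : ℝ} (ha : 0 < a) (hc : 0 < c) {m : Fin l → ℝ}
    (hm : ∀ i, 0 ≤ m i) (x : Fin l → ℕ) :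
    Tendsto (fun k : ℝ => waringMass a (fun i => k * m i) (c * k) x) atTop
      (𝓝 (negBinomialMass a c m x)) := by
  set M := ∑ i, m i with hM
  have hM0 : 0 ≤ M := Finset.sum_nonneg fun i _ => hm i
  have hcM : 0 < c + M := by linarith
  set s : ℝ := ∑ i, (x i : ℝ) with hsdef
  have hs0 : 0 ≤ s := Finset.sum_nonneg fun i _ => Nat.cast_nonneg _
  have hG1 : Tendsto (fun k : ℝ => Real.Gamma (c * k + a) / (Real.Gamma (c * k) * (c * k) ^ a))
      atTop (𝓝 1) :=
    (tendsto_Gamma_add_div ha.le).comp (tendsto_id.const_mul_atTop hc)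
  have hG2 : Tendsto (fun k : ℝ => Real.Gamma ((c + M) * k + (a + s)) /
      (Real.Gamma ((c + M) * k) * ((c + M) * k) ^ (a + s))) atTop (𝓝 1) :=
    (tendsto_Gamma_add_div (by positivity)).comp (tendsto_id.const_mul_atTop hcM)
  have hP : Tendsto (fun k : ℝ => ∏ i, (ascPochhammer ℝ (x i)).eval (k * m i) / k ^ x i /
      ((x i).factorial : ℝ)) atTop (𝓝 (∏ i, m i ^ x i / ((x i).factorial : ℝ))) :=
    tendsto_finsetProd _ fun i _ =>
      (tendsto_ascPochhammer_eval_mul_div_pow (m i) (x i)).div_const _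
  have hlim := ((hG1.div hG2 one_ne_zero).const_mul
    (risingFactorial a s * c ^ a / (c + M) ^ (a + s))).mul hP
  rw [div_one, mul_one] at hlim
  refine hlim.congr' ?_
  filter_upwards [eventually_gt_atTop 0] with k hk
  have hck : 0 < c * k := by positivity
  have hcMk : 0 < (c + M) * k := by positivity
  have e1 := (Real.Gamma_pos_of_pos hck).ne'
  have e2 := (Real.Gamma_pos_of_pos hcMk).ne'
  have e3 := (Real.Gamma_pos_of_pos (show 0 < c * k + a by positivity)).ne'
  have e4 := (Real.Gamma_pos_of_pos (show 0 < (c + M) * k + (a + s) by positivity)).ne'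
  have hprod : ∏ i, (ascPochhammer ℝ (x i)).eval (k * m i) / k ^ x i / ((x i).factorial : ℝ) =
      (∏ i, (ascPochhammer ℝ (x i)).eval (k * m i) / ((x i).factorial : ℝ)) / k ^ s := by
    rw [hsdef, ← Nat.cast_sum, Real.rpow_natCast, ← Finset.prod_pow_eq_pow_sum,
      ← Finset.prod_div_distrib]
    exact Finset.prod_congr rfl fun i _ => div_right_comm _ _ _
  have hsum : ∑ i, k * m i = k * M := by rw [hM, Finset.mul_sum]
  simp only [waringMass, risingFactorial, hsum, ← hsdef, Pi.div_apply]
  rw [hprod, Real.mul_rpow hc.le hk.le, Real.mul_rpow hcM.le hk.le, Real.rpow_add hk,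
    show c * k + k * M = (c + M) * k by ring,
    show c * k + a + (k * M + s) = (c + M) * k + (a + s) by ring]
  have e5 := (Real.rpow_pos_of_pos hk a).ne'
  have e6 := (Real.rpow_pos_of_pos hk s).ne'
  have e7 := (Real.rpow_pos_of_pos hc a).ne'
  have e8 := (Real.rpow_pos_of_pos hcM (a + s)).ne'
  field_simp

end GammaAsymptotics

/-! ### Generating functions -/

section GeneratingFunctions

/-- **Tonelli's theorem** for a product of functions of the coordinates. -/
lemma lintegral_pi_fin_prod {α : Type*} [MeasurableSpace α] {n : ℕ} (ν : Fin n → Measure α)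
    [∀ i, SigmaFinite (ν i)] {f : Fin n → α → ℝ≥0∞} (hf : ∀ i, Measurable (f i)) :
    ∫⁻ x, ∏ i, f i (x i) ∂(Measure.pi ν) = ∏ i, ∫⁻ x, f i x ∂(ν i) := by
  induction n with
  | zero => simp
  | succ n ih =>
    have hprod : Measurable fun x : Fin n → α => ∏ i : Fin n, f i.succ (x i) :=
      Finset.measurable_fun_prod _ fun i _ => (hf i.succ).comp (measurable_pi_apply i)
    rw [← ((measurePreserving_piFinSuccAbove ν 0).symm).lintegral_comp_emb
      (MeasurableEquiv.measurableEmbedding _)]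
    simp_rw [MeasurableEquiv.piFinSuccAbove_symm_apply, Fin.insertNthEquiv,
      Fin.prod_univ_succ, Fin.insertNth_zero, Equiv.coe_fn_mk, Fin.cons_succ, Fin.zero_succAbove,
      cast_eq, Fin.cons_zero]
    rw [← ih (fun i => ν i.succ) (fun i => hf i.succ),
      ← lintegral_prod_mul (hf 0).aemeasurable hprod.aemeasurable]

/-- If two power series agree on `[0, 1]` and have the same coefficients below `n`, then their
`n`-th coefficients compare; the symmetric statement gives equality. -/
lemma le_of_tsum_mul_pow_eq {p q : ℕ → ℝ≥0∞} (hq : ∑' n, q n ≠ ∞)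
    (h : ∀ z : ℝ≥0, z ≤ 1 → ∑' n, p n * (z : ℝ≥0∞) ^ n = ∑' n, q n * (z : ℝ≥0∞) ^ n) (n : ℕ)
    (hlt : ∀ i < n, p i = q i) : p n ≤ q n := by
  set C := ∑' n, q n
  have hqfin : ∀ i, q i ≠ ∞ := fun i => ne_top_of_le_ne_top hq (ENNReal.le_tsum i)
  -- Compare the coefficients of `z ^ n` and let `z` tend to zero.
  have key : ∀ z : ℝ≥0, 0 < z → z ≤ 1 → p n ≤ q n + z * C := by
    intro z hz hz1
    have hz1' : (z : ℝ≥0∞) ≤ 1 := by exact_mod_cast hz1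
    have hz0 : (z : ℝ≥0∞) ^ n ≠ 0 := pow_ne_zero _ (by exact_mod_cast hz.ne')
    have hzt : (z : ℝ≥0∞) ^ n ≠ ∞ := ENNReal.pow_ne_top ENNReal.coe_ne_top
    have h1 : ∑ i ∈ Finset.range n, q i * (z : ℝ≥0∞) ^ i + p n * (z : ℝ≥0∞) ^ n
        ≤ ∑ i ∈ Finset.range n, q i * (z : ℝ≥0∞) ^ i +
          (q n * (z : ℝ≥0∞) ^ n + (z : ℝ≥0∞) ^ (n + 1) * C) := by
      calc ∑ i ∈ Finset.range n, q i * (z : ℝ≥0∞) ^ i + p n * (z : ℝ≥0∞) ^ n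
          = ∑ i ∈ Finset.range (n + 1), p i * (z : ℝ≥0∞) ^ i := by
            rw [Finset.sum_range_succ]
            congr 1
            exact Finset.sum_congr rfl fun i hi => by rw [hlt i (Finset.mem_range.1 hi)]
        _ ≤ ∑' i, p i * (z : ℝ≥0∞) ^ i := ENNReal.sum_le_tsum _
        _ = ∑' i, q i * (z : ℝ≥0∞) ^ i := h z hz1
        _ = ∑ i ∈ Finset.range (n + 1), q i * (z : ℝ≥0∞) ^ i +
            ∑' i, q (i + (n + 1)) * (z : ℝ≥0∞) ^ (i + (n + 1)) :=
          (ENNReal.summable.sum_add_tsum_nat_add' (k := n + 1)).symm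
        _ ≤ ∑ i ∈ Finset.range (n + 1), q i * (z : ℝ≥0∞) ^ i + (z : ℝ≥0∞) ^ (n + 1) * C := by
          gcongr
          calc ∑' i, q (i + (n + 1)) * (z : ℝ≥0∞) ^ (i + (n + 1))
              ≤ ∑' i, (z : ℝ≥0∞) ^ (n + 1) * q (i + (n + 1)) := by
                refine ENNReal.tsum_le_tsum fun i => ?_
                rw [mul_comm]
                gcongr ?_ * _
                exact pow_le_pow_right_of_le_one' hz1' (Nat.le_add_left _ _)
            _ = (z : ℝ≥0∞) ^ (n + 1) * ∑' i, q (i + (n + 1)) := ENNReal.tsum_mul_left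
            _ ≤ _ := by
              gcongr
              exact ENNReal.tsum_comp_le_tsum_of_injective (add_left_injective (n + 1)) q
        _ = _ := by rw [Finset.sum_range_succ, add_assoc]
    have hfin : ∑ i ∈ Finset.range n, q i * (z : ℝ≥0∞) ^ i ≠ ∞ :=
      ENNReal.sum_ne_top.2 fun i _ =>
        ENNReal.mul_ne_top (hqfin i) (ENNReal.pow_ne_top ENNReal.coe_ne_top)
    have h2 := (ENNReal.add_le_add_iff_left hfin).1 h1
    rw [show q n * (z : ℝ≥0∞) ^ n + (z : ℝ≥0∞) ^ (n + 1) * C = (q n + z * C) * (z : ℝ≥0∞) ^ n by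
      ring] at h2
    exact (ENNReal.mul_le_mul_iff_left hz0 hzt).1 h2
  refine ENNReal.le_of_forall_pos_le_add fun ε hε _ => ?_
  obtain ⟨z, hz0, hz⟩ := ENNReal.exists_nnreal_pos_mul_lt hq (ENNReal.coe_pos.2 hε).ne'
  refine (key (min z 1) (lt_min hz0 one_pos) (min_le_right _ _)).trans ?_
  gcongr
  refine le_trans ?_ hz.le
  gcongr
  exact min_le_left _ _

lemma eq_of_tsum_mul_pow_eq {p q : ℕ → ℝ≥0∞} (hp : ∑' n, p n ≠ ∞) (hq : ∑' n, q n ≠ ∞)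
    (h : ∀ z : ℝ≥0, z ≤ 1 → ∑' n, p n * (z : ℝ≥0∞) ^ n = ∑' n, q n * (z : ℝ≥0∞) ^ n) :
    p = q := by
  funext n
  induction n using Nat.strong_induction_on with
  | _ n ih =>
    exact le_antisymm (le_of_tsum_mul_pow_eq hq h n ih)
      (le_of_tsum_mul_pow_eq hp (fun z hz => (h z hz).symm) n fun i hi => (ih i hi).symm)

/-- A summable family on `ℕ ^ l` is determined by its multivariate generating function: for fixed
values of the other variables, compare the coefficients of the powers of the first one. -/
lemma eq_of_tsum_mul_prod_pow_eq {l : ℕ} {p q : (Fin l → ℕ) → ℝ≥0∞} (hp : ∑' x, p x ≠ ∞)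
    (hq : ∑' x, q x ≠ ∞)
    (h : ∀ z : Fin l → ℝ≥0, (∀ i, z i ≤ 1) →
      ∑' x, p x * ∏ i, (z i : ℝ≥0∞) ^ x i = ∑' x, q x * ∏ i, (z i : ℝ≥0∞) ^ x i) :
    p = q := by
  induction l with
  | zero =>
    have h0 := h 0 fun _ => zero_le
    simp only [Finset.univ_eq_empty, Finset.prod_empty, mul_one, tsum_fintype,
      Finset.univ_unique, Finset.sum_singleton] at h0
    funext x
    convert h0
  | succ l ih =>
    have hcons : ∀ f : (Fin (l + 1) → ℕ) → ℝ≥0∞,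
        ∑' x, f x = ∑' (n : ℕ) (y : Fin l → ℕ), f (Fin.cons n y) := by
      intro f
      rw [← (Fin.consEquiv fun _ : Fin (l + 1) => ℕ).tsum_eq f, ENNReal.tsum_prod']
      rfl
    have hslice : ∀ {f : (Fin (l + 1) → ℕ) → ℝ≥0∞}, ∑' x, f x ≠ ∞ → ∀ n : ℕ,
        ∑' y : Fin l → ℕ, f (Fin.cons n y) ≠ ∞ := by
      intro f hf n
      rw [hcons] at hf
      exact ne_top_of_le_ne_top hf
        (ENNReal.le_tsum (f := fun n => ∑' y : Fin l → ℕ, f (Fin.cons n y)) n)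
    have hle : ∀ (f : (Fin l → ℕ) → ℝ≥0∞) (z : Fin l → ℝ≥0), (∀ i, z i ≤ 1) →
        ∑' y, f y * ∏ i, (z i : ℝ≥0∞) ^ y i ≤ ∑' y, f y := by
      intro f z hz
      refine ENNReal.tsum_le_tsum fun y => mul_le_of_le_one_right' ?_
      refine Finset.prod_le_one' fun i _ => pow_le_one' ?_ _
      exact_mod_cast hz i
    have hslices : ∀ z : Fin l → ℝ≥0, (∀ i, z i ≤ 1) →
        (fun n : ℕ => ∑' y : Fin l → ℕ, p (Fin.cons n y) * ∏ i, (z i : ℝ≥0∞) ^ y i) =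
        fun n : ℕ => ∑' y : Fin l → ℕ, q (Fin.cons n y) * ∏ i, (z i : ℝ≥0∞) ^ y i := by
      intro z hz
      refine eq_of_tsum_mul_pow_eq ?_ ?_ fun w hw => ?_
      · exact ne_top_of_le_ne_top (hcons p ▸ hp) (ENNReal.tsum_le_tsum fun n => hle _ z hz)
      · exact ne_top_of_le_ne_top (hcons q ▸ hq) (ENNReal.tsum_le_tsum fun n => hle _ z hz)
      · have := h (Fin.cons w z) (Fin.cases hw hz)
        rw [hcons, hcons (fun x => q x * _)] at this
        simp only [Fin.prod_univ_succ, Fin.cons_zero, Fin.cons_succ] at this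
        convert this using 2 <;>
        · funext n
          rw [← ENNReal.tsum_mul_right]
          refine tsum_congr fun y => ?_
          ring
    funext x
    rw [← Fin.cons_self_tail x]
    exact congrFun (ih (hslice hp (x 0)) (hslice hq (x 0))
      fun z hz => congrFun (hslices z hz) (x 0)) (Fin.tail x)

lemma measure_ext_of_lintegral_prod_pow_eq {l : ℕ} {ρ σ : Measure (Fin l → ℕ)} [IsFiniteMeasure ρ]
    [IsFiniteMeasure σ]
    (h : ∀ z : Fin l → ℝ≥0, (∀ i, z i ≤ 1) →
      ∫⁻ x, ∏ i, (z i : ℝ≥0∞) ^ x i ∂ρ = ∫⁻ x, ∏ i, (z i : ℝ≥0∞) ^ x i ∂σ) :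
    ρ = σ := by
  have hfin : ∀ (ρ : Measure (Fin l → ℕ)) [IsFiniteMeasure ρ], ∑' x, ρ {x} ≠ ∞ := by
    intro ρ _
    have := lintegral_countable' (μ := ρ) (fun _ => (1 : ℝ≥0∞))
    simp only [lintegral_const, one_mul] at this
    exact this ▸ measure_ne_top ρ Set.univ
  refine Measure.ext_of_singleton fun x => congrFun (eq_of_tsum_mul_prod_pow_eq
    (p := fun x => ρ {x}) (q := fun x => σ {x}) (hfin ρ) (hfin σ) fun z hz => ?_) x
  have := h z hz
  rw [lintegral_countable', lintegral_countable'] at this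
  simpa only [mul_comm] using this

lemma tsum_ofReal_exp_series {x : ℝ} (hx : 0 ≤ x) :
    ∑' k : ℕ, ENNReal.ofReal (x ^ k / (k.factorial : ℝ)) = ENNReal.ofReal (Real.exp x) := by
  rw [← ENNReal.ofReal_tsum_of_nonneg (fun k => by positivity) (Real.summable_pow_div_factorial x),
    Real.exp_eq_exp_ℝ, NormedSpace.exp_eq_tsum_div]

lemma lintegral_pow_poissonMeasure (r z : ℝ≥0) :
    ∫⁻ n, (z : ℝ≥0∞) ^ n ∂ProbabilityTheory.poissonMeasure r =
      ENNReal.ofReal (Real.exp (r * (z - 1))) := by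
  rw [lintegral_countable']
  simp_rw [ProbabilityTheory.poissonMeasure_singleton]
  calc ∑' n : ℕ, (z : ℝ≥0∞) ^ n * ENNReal.ofReal (Real.exp (-r) * r ^ n / n.factorial)
      = ∑' n : ℕ, ENNReal.ofReal (Real.exp (-r)) *
          ENNReal.ofReal ((r * z : ℝ) ^ n / n.factorial) := by
        refine tsum_congr fun n => ?_
        rw [← ENNReal.ofReal_coe_nnreal, ← ENNReal.ofReal_pow (by positivity),
          ← ENNReal.ofReal_mul (by positivity), ← ENNReal.ofReal_mul (by positivity)]
        congr 1
        rw [mul_pow]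
        ring
    _ = ENNReal.ofReal (Real.exp (-r)) * ENNReal.ofReal (Real.exp (r * z)) := by
        rw [ENNReal.tsum_mul_left, tsum_ofReal_exp_series (by positivity)]
    _ = _ := by
        rw [← ENNReal.ofReal_mul (by positivity), ← Real.exp_add]
        congr 2
        ring

end GeneratingFunctions

/-! ### Poisson configurations and Poisson processes -/

section PoissonProcess

/-- Finite ordered configurations of points of `S`: a number of points and the list of the points.
Repetitions are allowed. -/
abbrev Config (S : Type*) := Σ k : ℕ, Fin k → S

/-- The number of points of a finite configuration which lie in `A`. -/
noncomputable def Config.count {S : Type*} (t : Config S) (A : Set S) : ℕ :=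
  ∑ i, A.indicator (fun _ => 1) (t.2 i)

variable {S : Type*} [MeasurableSpace S]

lemma measurable_config {β : Type*} [MeasurableSpace β] {f : Config S → β}
    (h : ∀ k, Measurable fun x : Fin k → S => f ⟨k, x⟩) : Measurable f := fun _ hs =>
  MeasurableSpace.measurableSet_iInf.2 fun k => h k hs

lemma measurable_configMk (k : ℕ) : Measurable fun x : Fin k → S => (⟨k, x⟩ : Config S) :=
  fun _ hs => MeasurableSpace.measurableSet_iInf.1 hs k

lemma Config.measurable_count {A : Set S} (hA : MeasurableSet A) :
    Measurable fun t : Config S => t.count A :=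
  measurable_config fun k => Finset.measurable_fun_sum Finset.univ
    (f := fun i (x : Fin k → S) => A.indicator (fun _ => 1) (x i)) fun i _ =>
      (measurable_const.indicator hA).comp (measurable_pi_apply i)

/-- The law of a Poisson configuration with intensity `r • ν`, for a finite measure `ν`: the
restriction of the law to configurations of `k` points is
`exp (- r * ν(S)) * r ^ k / k!` times the `k`-th power of `ν`. -/
noncomputable def poissonConfig (ν : Measure S) (r : ℝ≥0) : Measure (Config S) :=
  Measure.sum fun k : ℕ =>
    ENNReal.ofReal (Real.exp (-(r * ν.real Set.univ)) * (r ^ k / (k.factorial : ℝ))) •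
      (Measure.pi fun _ : Fin k => ν).map fun x => (⟨k, x⟩ : Config S)

lemma measurable_poissonConfig_apply (ν : Measure S) {s : Set (Config S)} (hs : MeasurableSet s) :
    Measurable fun r : ℝ≥0 => poissonConfig ν r s := by
  simp only [poissonConfig, Measure.sum_apply _ hs, Measure.smul_apply, smul_eq_mul]
  refine .tsum fun k => Measurable.mul_const ?_ _
  fun_prop

/-- The generating functional of a Poisson configuration. -/
lemma lintegral_prod_poissonConfig (ν : Measure S) [IsFiniteMeasure ν] (r : ℝ≥0) {g : S → ℝ≥0∞}
    (hg : Measurable g) (hfin : ∫⁻ x, g x ∂ν ≠ ∞) :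
    ∫⁻ t, ∏ i, g (t.2 i) ∂(poissonConfig ν r) =
      ENNReal.ofReal (Real.exp (r * ((∫⁻ x, g x ∂ν).toReal - ν.real Set.univ))) := by
  have hmeas : Measurable fun t : Config S => ∏ i, g (t.2 i) :=
    measurable_config fun k => Finset.measurable_fun_prod Finset.univ
      (f := fun i (x : Fin k → S) => g (x i)) fun i _ => hg.comp (measurable_pi_apply i)
  set G := (∫⁻ x, g x ∂ν).toReal with hG
  have hG0 : 0 ≤ G := ENNReal.toReal_nonneg
  rw [poissonConfig, lintegral_sum_measure]
  calc _ = ∑' k : ℕ, ENNReal.ofReal (Real.exp (-(r * ν.real Set.univ))) *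
        ENNReal.ofReal ((r * G : ℝ) ^ k / (k.factorial : ℝ)) := by
        refine tsum_congr fun k => ?_
        rw [lintegral_smul_measure, lintegral_map hmeas (measurable_configMk k),
          lintegral_pi_fin_prod (fun _ => ν) (fun _ => hg), Finset.prod_const, Finset.card_univ,
          Fintype.card_fin, smul_eq_mul, ← ENNReal.ofReal_toReal hfin, ← hG,
          ← ENNReal.ofReal_pow hG0, ← ENNReal.ofReal_mul (by positivity),
          ← ENNReal.ofReal_mul (by positivity)]
        congr 1
        rw [mul_pow]
        ring
    _ = _ := by
        rw [ENNReal.tsum_mul_left, tsum_ofReal_exp_series (by positivity),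
          ← ENNReal.ofReal_mul (by positivity), ← Real.exp_add]
        congr 2
        ring

instance (ν : Measure S) [IsFiniteMeasure ν] (r : ℝ≥0) :
    IsProbabilityMeasure (poissonConfig ν r) := by
  refine ⟨?_⟩
  have := lintegral_prod_poissonConfig ν r (g := fun _ => 1) measurable_const
    (by simp [measure_ne_top])
  simpa [Measure.real] using this

/-- The joint generating function of the counts of disjoint sets in a Poisson configuration. -/
lemma lintegral_prod_pow_count (ν : Measure S) [IsFiniteMeasure ν] (r : ℝ≥0) {l : ℕ}
    {A : Fin l → Set S} (hA : ∀ i, MeasurableSet (A i))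
    (hd : Pairwise fun i j => Disjoint (A i) (A j)) {z : Fin l → ℝ≥0} (hz : ∀ i, z i ≤ 1) :
    ∫⁻ t, ∏ i, (z i : ℝ≥0∞) ^ t.count (A i) ∂(poissonConfig ν r) =
      ENNReal.ofReal (Real.exp (r * ∑ i, (z i - 1) * ν.real (A i))) := by
  let g : S → ℝ≥0∞ := fun x => ∏ i, (z i : ℝ≥0∞) ^ (A i).indicator (fun _ => 1) x
  have hg : Measurable g := Finset.measurable_fun_prod _ fun i _ =>
    (measurable_of_countable fun n : ℕ => (z i : ℝ≥0∞) ^ n).comp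
      (measurable_const.indicator (hA i))
  -- At each point at most one factor of `g` differs from `1`.
  have hone : ∀ x, g x + ∑ i, (A i).indicator (fun _ => 1 - (z i : ℝ≥0∞)) x = 1 := by
    intro x
    by_cases hx : ∃ i, x ∈ A i
    · obtain ⟨i, hi⟩ := hx
      have hj : ∀ j, j ≠ i → x ∉ A j := fun j hji hxj =>
        Set.disjoint_left.1 (hd hji) hxj hi
      have h1 : g x = z i := by
        simp only [g]
        rw [Finset.prod_eq_single i (fun j _ hji => by simp [hj j hji]) (by simp)]
        simp [hi]
      rw [h1, Finset.sum_eq_single i (fun j _ hji => by simp [hj j hji]) (by simp)]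
      simp only [hi, Set.indicator_of_mem]
      exact add_tsub_cancel_of_le (by exact_mod_cast hz i)
    · push Not at hx
      simp [g, hx]
  have hint : ∫⁻ x, g x ∂ν + ∑ i, (1 - (z i : ℝ≥0∞)) * ν (A i) = ν Set.univ := by
    have h1 : ∀ i, ∫⁻ x, (A i).indicator (fun _ => 1 - (z i : ℝ≥0∞)) x ∂ν =
        (1 - (z i : ℝ≥0∞)) * ν (A i) := fun i => by
      rw [lintegral_indicator_const (hA i)]
    simp_rw [← h1]
    rw [← lintegral_finsetSum _ fun i _ => measurable_const.indicator (hA i),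
      ← lintegral_add_left hg]
    simp [hone]
  have hfin : ∫⁻ x, g x ∂ν ≠ ∞ :=
    ne_top_of_le_ne_top (measure_ne_top ν Set.univ) (hint ▸ le_self_add)
  have hfin2 : ∀ i ∈ Finset.univ, (1 - (z i : ℝ≥0∞)) * ν (A i) ≠ ∞ := fun i _ =>
    ENNReal.mul_ne_top (by finiteness) (measure_ne_top _ _)
  have hreal := congrArg ENNReal.toReal hint
  rw [ENNReal.toReal_add hfin (ENNReal.sum_ne_top.2 hfin2), ENNReal.toReal_sum hfin2] at hreal
  have hterm : ∀ i, ((1 - (z i : ℝ≥0∞)) * ν (A i)).toReal = -((z i - 1) * ν.real (A i)) := by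
    intro i
    rw [ENNReal.toReal_mul, ENNReal.toReal_sub_of_le (by exact_mod_cast hz i) ENNReal.one_ne_top]
    simp only [ENNReal.toReal_one, ENNReal.coe_toReal, Measure.real]
    ring
  simp only [hterm, Finset.sum_neg_distrib] at hreal
  have hprod : ∀ t : Config S, ∏ i, (z i : ℝ≥0∞) ^ t.count (A i) = ∏ n, g (t.2 n) := by
    intro t
    simp only [g, Config.count, ← Finset.prod_pow_eq_pow_sum]
    exact Finset.prod_comm
  simp_rw [hprod]
  rw [lintegral_prod_poissonConfig ν r hg hfin]
  congr 3
  change _ = ν.real Set.univ at hreal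
  linarith

/-- The sum of the unit masses at the points of the configurations `ω j`, where of `ω j` only the
points in the cell `B j` are kept. -/
noncomputable def superposition (B : ℕ → Set S) (ω : ℕ → Config S) : Measure S :=
  Measure.sum fun j => ∑ i, (Measure.dirac ((ω j).2 i)).restrict (B j)

lemma superposition_apply {B : ℕ → Set S} (hB : ∀ j, MeasurableSet (B j)) (ω : ℕ → Config S)
    {A : Set S} (hA : MeasurableSet A) {J : ℕ} (hJ : ∀ j, J ≤ j → Disjoint A (B j)) :
    superposition B ω A = ((∑ j ∈ Finset.range J, (ω j).count (A ∩ B j) : ℕ) : ℝ≥0∞) := by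
  rw [superposition, Measure.sum_apply _ hA, tsum_eq_sum (s := Finset.range J)]
  · push_cast
    refine Finset.sum_congr rfl fun j _ => ?_
    simp only [Measure.coe_finsetSum, Finset.sum_apply, Measure.restrict_apply hA,
      Measure.dirac_apply' _ (hA.inter (hB j)), Config.count]
    push_cast
    refine Finset.sum_congr rfl fun i _ => ?_
    by_cases h : (ω j).2 i ∈ A ∩ B j <;> simp only [h, Set.indicator_of_mem,
      Set.indicator_of_notMem, not_false_eq_true, Pi.one_apply, Nat.cast_one, Nat.cast_zero]
  · intro j hj
    have hd := (hJ j (by simpa using hj)).inter_eq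
    simp [Measure.restrict_apply hA, hd]

/-- The law of a family of independent Poisson configurations with intensities `r • ν j`. -/
noncomputable def poissonFamily (ν : ℕ → Measure S) [∀ j, IsFiniteMeasure (ν j)] (r : ℝ≥0) :
    Measure (ℕ → Config S) :=
  Measure.infinitePi fun j => poissonConfig (ν j) r

instance (ν : ℕ → Measure S) [∀ j, IsFiniteMeasure (ν j)] (r : ℝ≥0) :
    IsProbabilityMeasure (poissonFamily ν r) := by
  unfold poissonFamily
  infer_instance

lemma measurable_poissonFamily (ν : ℕ → Measure S) [∀ j, IsFiniteMeasure (ν j)] :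
    Measurable (poissonFamily ν) := by
  refine Measurable.measure_of_isPiSystem_of_isProbabilityMeasure generateFrom_squareCylinders.symm
    (isPiSystem_squareCylinders (fun _ => MeasurableSpace.isPiSystem_measurableSet)
      fun _ => by simp) ?_
  rintro s ⟨I, t, ht, rfl⟩
  have ht' : ∀ i, MeasurableSet (t i) := fun i => ht i (Set.mem_univ i)
  simp only [poissonFamily, Measure.infinitePi_pi _ fun i _ => ht' i]
  exact Finset.measurable_fun_prod _ fun j _ => measurable_poissonConfig_apply (ν j) (ht' j)

/-- For Poisson configurations in disjoint cells, the total counts of disjoint sets `A i` which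
meet finitely many of the cells are independent Poisson variables. -/
lemma map_count_poissonFamily {μ : Measure S} {B : ℕ → Set S} (hB : ∀ j, MeasurableSet (B j))
    (hBd : Pairwise fun i j => Disjoint (B i) (B j)) (hBu : ⋃ j, B j = Set.univ)
    [∀ j, IsFiniteMeasure (μ.restrict (B j))] (r : ℝ≥0) {l : ℕ} {A : Fin l → Set S}
    (hA : ∀ i, MeasurableSet (A i)) (hd : Pairwise fun i j => Disjoint (A i) (A j)) {J : ℕ}
    (hJ : ∀ i j, J ≤ j → Disjoint (A i) (B j)) :
    (poissonFamily (fun j => μ.restrict (B j)) r).map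
        (fun ω i => ∑ j ∈ Finset.range J, (ω j).count (A i ∩ B j)) =
      Measure.pi fun i => ProbabilityTheory.poissonMeasure (r * (μ (A i)).toNNReal) := by
  have hcount : ∀ i j, Measurable fun ω : ℕ → Config S => (ω j).count (A i ∩ B j) := fun i j =>
    (Config.measurable_count ((hA i).inter (hB j))).comp (measurable_pi_apply j)
  have hmeas : Measurable fun (ω : ℕ → Config S) (i : Fin l) =>
      ∑ j ∈ Finset.range J, (ω j).count (A i ∩ B j) :=
    measurable_pi_lambda _ fun i => Finset.measurable_fun_sum _ fun j _ => hcount i j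
  have := Measure.isProbabilityMeasure_map (μ := poissonFamily (fun j => μ.restrict (B j)) r)
    hmeas.aemeasurable
  refine measure_ext_of_lintegral_prod_pow_eq fun z hz => ?_
  rw [lintegral_map (measurable_of_countable _) hmeas,
    lintegral_pi_fin_prod _ (f := fun i n => (z i : ℝ≥0∞) ^ n) fun i => measurable_of_countable _]
  simp_rw [lintegral_pow_poissonMeasure, ← Finset.prod_pow_eq_pow_sum]
  have hswap : ∀ ω : ℕ → Config S, ∏ i, ∏ j ∈ Finset.range J,
      (z i : ℝ≥0∞) ^ (ω j).count (A i ∩ B j) =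
      ∏ j ∈ Finset.range J, ∏ i, (z i : ℝ≥0∞) ^ (ω j).count (A i ∩ B j) := fun ω =>
    Finset.prod_comm
  have hφ : ∀ j, Measurable fun t : Config S => ∏ i, (z i : ℝ≥0∞) ^ t.count (A i ∩ B j) :=
    fun j => Finset.measurable_fun_prod _ fun i _ =>
      (measurable_of_countable fun n : ℕ => (z i : ℝ≥0∞) ^ n).comp
        (Config.measurable_count ((hA i).inter (hB j)))
  simp_rw [hswap]
  have hind := ProbabilityTheory.iIndepFun_infinitePi
    (P := fun j => poissonConfig (μ.restrict (B j)) r) hφ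
  rw [poissonFamily, ProbabilityTheory.lintegral_prod_eq_prod_lintegral_of_indepFun _ _ hind
    fun j => (hφ j).comp (measurable_pi_apply j)]
  have hfactor : ∀ j, ∫⁻ ω, ∏ i, (z i : ℝ≥0∞) ^ (ω j).count (A i ∩ B j)
      ∂(Measure.infinitePi fun j => poissonConfig (μ.restrict (B j)) r) =
      ENNReal.ofReal (Real.exp (r * ∑ i, (z i - 1) * μ.real (A i ∩ B j))) := by
    intro j
    rw [(measurePreserving_eval_infinitePi (fun j => poissonConfig (μ.restrict (B j)) r)
      j).lintegral_comp (hφ j), lintegral_prod_pow_count (μ.restrict (B j)) r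
        (fun i => (hA i).inter (hB j))
        (fun i i' h => (hd h).mono Set.inter_subset_left Set.inter_subset_left) hz]
    simp [measureReal_restrict_apply ((hA _).inter (hB j)), Set.inter_assoc]
  have hsplit : ∀ i, μ.real (A i) = ∑ j ∈ Finset.range J, μ.real (A i ∩ B j) := by
    intro i
    have hAeq : A i = ⋃ j ∈ Finset.range J, A i ∩ B j := by
      ext x
      simp only [Set.mem_iUnion, Finset.mem_range, Set.mem_inter_iff, exists_prop]
      refine ⟨fun hx => ?_, fun ⟨j, _, hx, _⟩ => hx⟩
      obtain ⟨j, hj⟩ := Set.mem_iUnion.1 (hBu ▸ Set.mem_univ x)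
      exact ⟨j, not_le.1 fun h => Set.disjoint_left.1 (hJ i j h) hx hj, hx, hj⟩
    conv_lhs => rw [hAeq]
    refine measureReal_biUnion_finset (fun j _ j' _ h => (hBd h).mono Set.inter_subset_right
      Set.inter_subset_right) (fun j _ => (hA i).inter (hB j)) fun j _ => ?_
    rw [← Measure.restrict_apply (hA i)]
    exact measure_ne_top _ _
  simp_rw [hfactor]
  rw [← ENNReal.ofReal_prod_of_nonneg fun _ _ => (Real.exp_pos _).le,
    ← ENNReal.ofReal_prod_of_nonneg fun _ _ => (Real.exp_pos _).le, ← Real.exp_sum,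
    ← Real.exp_sum, ← Finset.mul_sum, Finset.sum_comm]
  congr 2
  rw [Finset.mul_sum]
  refine Finset.sum_congr rfl fun i _ => ?_
  rw [← Finset.mul_sum, ← hsplit, NNReal.coe_mul, ENNReal.coe_toNNReal_eq_toReal]
  change _ = r * μ.real (A i) * (z i - 1)
  ring

end PoissonProcess

/-! ### Existence of the negative binomial process and convergence -/

section Existence

lemma negBinomialMass_nonneg {l : ℕ} {a c : ℝ} (ha : 0 < a) (hc : 0 < c) {m : Fin l → ℝ}
    (hm : ∀ i, 0 ≤ m i) (x : Fin l → ℕ) : 0 ≤ negBinomialMass a c m x := by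
  have hs : 0 ≤ ∑ i, (x i : ℝ) := Finset.sum_nonneg fun i _ => Nat.cast_nonneg _
  have hM : 0 ≤ ∑ i, m i := Finset.sum_nonneg fun i _ => hm i
  have h1 := Real.Gamma_pos_of_pos ha
  have h2 := Real.Gamma_pos_of_pos (add_pos_of_pos_of_nonneg ha hs)
  have h3 : 0 ≤ ∏ i, m i ^ x i / ((x i).factorial : ℝ) :=
    Finset.prod_nonneg fun i _ => div_nonneg (pow_nonneg (hm i) _) (Nat.cast_nonneg _)
  unfold negBinomialMass risingFactorial
  positivity

/-- The negative binomial probabilities are Gamma mixtures of products of Poisson probabilities. -/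
lemma lintegral_gammaMeasure_poisson {l : ℕ} {a c : ℝ} (ha : 0 < a) (hc : 0 < c)
    (m : Fin l → ℝ≥0) (x : Fin l → ℕ) :
    ∫⁻ t, ∏ i, ProbabilityTheory.poissonMeasure (t.toNNReal * m i) {x i}
      ∂(ProbabilityTheory.gammaMeasure a c) =
      ENNReal.ofReal (negBinomialMass a c (fun i => m i) x) := by
  set M : ℝ := ∑ i, (m i : ℝ) with hM
  set s : ℝ := ∑ i, (x i : ℝ) with hs
  have hM0 : 0 ≤ M := Finset.sum_nonneg fun i _ => (m i).2
  have hs0 : 0 ≤ s := Finset.sum_nonneg fun i _ => Nat.cast_nonneg _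
  have hcM : 0 < c + M := by linarith
  have has : 0 < a + s := by linarith
  have hprod : ∀ t : ℝ, 0 < t → ∏ i, ProbabilityTheory.poissonMeasure (t.toNNReal * m i) {x i} =
      ENNReal.ofReal (Real.exp (-(t * M)) * t ^ s *
        ∏ i, (m i : ℝ) ^ x i / ((x i).factorial : ℝ)) := by
    intro t ht
    simp_rw [ProbabilityTheory.poissonMeasure_singleton]
    rw [← ENNReal.ofReal_prod_of_nonneg fun i _ => by positivity]
    congr 1
    rw [hM, hs, Finset.mul_sum, ← Finset.sum_neg_distrib, Real.exp_sum, ← Nat.cast_sum,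
      Real.rpow_natCast, ← Finset.prod_pow_eq_pow_sum, ← Finset.prod_mul_distrib,
      ← Finset.prod_mul_distrib]
    refine Finset.prod_congr rfl fun i _ => ?_
    rw [NNReal.coe_mul, Real.coe_toNNReal t ht.le, mul_pow]
    ring
  -- The integrand is a multiple of the Gamma density with parameters `a + s` and `c + M`.
  have hpdf : ∀ t : ℝ, t ≠ 0 → ProbabilityTheory.gammaPDF a c t *
      ∏ i, ProbabilityTheory.poissonMeasure (t.toNNReal * m i) {x i} =
      ENNReal.ofReal (negBinomialMass a c (fun i => m i) x) *
        ProbabilityTheory.gammaPDF (a + s) (c + M) t := by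
    intro t ht0
    rcases ht0.lt_or_gt with ht | ht
    · simp [ProbabilityTheory.gammaPDF_of_neg ht]
    have hG := Real.Gamma_pos_of_pos ha
    have hG' := Real.Gamma_pos_of_pos has
    have hnb : 0 ≤ negBinomialMass a c (fun i => (m i : ℝ)) x :=
      negBinomialMass_nonneg ha hc (fun i => (m i).2) x
    rw [hprod t ht, ProbabilityTheory.gammaPDF_of_nonneg ht.le,
      ProbabilityTheory.gammaPDF_of_nonneg ht.le, ← ENNReal.ofReal_mul (by positivity),
      ← ENNReal.ofReal_mul hnb]
    congr 1
    simp only [negBinomialMass, risingFactorial, ← hM, ← hs]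
    rw [show a + s - 1 = (a - 1) + s by ring, Real.rpow_add ht,
      show -((c + M) * t) = -(c * t) + -(t * M) by ring, Real.exp_add]
    have := (Real.rpow_pos_of_pos hcM (a + s)).ne'
    field_simp
  have hmeas : Measurable fun t : ℝ =>
      ∏ i, ProbabilityTheory.poissonMeasure (t.toNNReal * m i) {x i} := by
    simp_rw [ProbabilityTheory.poissonMeasure_singleton]
    fun_prop
  have hpdfm : ∀ b d, Measurable (ProbabilityTheory.gammaPDF b d) := fun b d =>
    (ProbabilityTheory.measurable_gammaPDFReal b d).ennreal_ofReal
  rw [ProbabilityTheory.gammaMeasure, lintegral_withDensity_eq_lintegral_mul _ (hpdfm a c) hmeas]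
  calc _ = ∫⁻ t, ENNReal.ofReal (negBinomialMass a c (fun i => m i) x) *
        ProbabilityTheory.gammaPDF (a + s) (c + M) t := by
        refine lintegral_congr_ae ?_
        filter_upwards [Measure.ae_ne volume (0 : ℝ)] with t ht using hpdf t ht
    _ = _ := by
        rw [lintegral_const_mul _ (hpdfm _ _), ProbabilityTheory.lintegral_gammaPDF_eq_one has hcM,
          mul_one]

variable {S : Type*} [MetricSpace S] [TopologicalSpace.SeparableSpace S] [MeasurableSpace S]
  [BorelSpace S]

/-- A negative binomial process is obtained as a Poisson process with intensity `Λ • μ`, where `Λ`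
has a Gamma distribution. -/
lemma exists_isNegativeBinomialProcess {μ : Measure S} (hμ : BoundedlyFinite μ) {a c : ℝ}
    (ha : 0 < a) (hc : 0 < c) :
    ∃ Q : ProbabilityMeasure (CountingMeasure S),
      IsNegativeBinomialProcess (Q : Measure (CountingMeasure S)) id a c μ := by
  obtain ⟨V, hVo, hVb, hVc, hVn⟩ := exists_seq_bounded_open_basis S
  -- A bounded set lies in some `V i`, so it meets only the cells `B 0, …, B i`.
  let B : ℕ → Set S := disjointed V
  have hBm : ∀ j, MeasurableSet (B j) := MeasurableSet.disjointed fun i => (hVo i).measurableSet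
  have hBd : Pairwise fun i j => Disjoint (B i) (B j) := disjoint_disjointed V
  have hBu : ⋃ j, B j = Set.univ := by
    rw [iUnion_disjointed]
    exact Set.eq_univ_of_forall fun x =>
      let ⟨i, hi, _⟩ := hVn x Set.univ Filter.univ_mem
      Set.mem_iUnion.2 ⟨i, hi⟩
  have hB : ∀ A, Bornology.IsBounded A → ∃ J, ∀ j, J ≤ j → Disjoint A (B j) := by
    intro A hA
    obtain ⟨i, hi⟩ := hVc A hA
    refine ⟨i + 1, fun j hj => Set.disjoint_left.2 fun x hx hxj => ?_⟩
    rw [show B j = disjointed V j from rfl, disjointed_eq_inter_compl] at hxj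
    exact Set.mem_iInter₂.1 hxj.2 i (Nat.lt_of_succ_le hj) (hi hx)
  have hfin : ∀ j, IsFiniteMeasure (μ.restrict (B j)) := fun j =>
    ⟨by simpa using hμ _ (hBm j) ((hVb j).subset (disjointed_subset V j))⟩
  let Φ : (ℕ → Config S) → CountingMeasure S := fun ω =>
    { toMeasure := superposition B ω
      natValued := fun A hA hb =>
        let ⟨_, hJ⟩ := hB A hb
        ⟨_, superposition_apply hBm ω hA hJ⟩ }
  have hΦ : Measurable Φ := by
    refine measurable_of_measurable_toMeasure fun A hA hb => ?_
    obtain ⟨J, hJ⟩ := hB A hb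
    have heq : (fun ω => (Φ ω).toMeasure A) = fun ω =>
        ((∑ j ∈ Finset.range J, (ω j).count (A ∩ B j) : ℕ) : ℝ≥0∞) :=
      funext fun ω => superposition_apply hBm ω hA hJ
    rw [heq]
    exact (measurable_of_countable fun n : ℕ => (n : ℝ≥0∞)).comp
      (Finset.measurable_fun_sum _ fun j _ =>
        (Config.measurable_count (hA.inter (hBm j))).comp (measurable_pi_apply j))
  have := ProbabilityTheory.isProbabilityMeasure_gammaMeasure ha hc
  -- The value for negative `t` is irrelevant: the Gamma distribution gives them no mass.
  let κ : ℝ → Measure (ℕ → Config S) := fun t =>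
    poissonFamily (fun j => μ.restrict (B j)) t.toNNReal
  have hκ : Measurable κ := (measurable_poissonFamily _).comp measurable_real_toNNReal
  let Q₀ : Measure (ℕ → Config S) := (ProbabilityTheory.gammaMeasure a c).bind κ
  have hQ₀ : IsProbabilityMeasure Q₀ := by
    refine ⟨?_⟩
    rw [Measure.bind_apply MeasurableSet.univ hκ.aemeasurable]
    simp [κ]
  refine ⟨⟨Q₀.map Φ, Measure.isProbabilityMeasure_map hΦ.aemeasurable⟩, measurable_id,
    fun l A hA hAb hAd x => ?_⟩
  choose J hJ using fun i => hB (A i) (hAb i)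
  have hJ' : ∀ i j, Finset.univ.sup J ≤ j → Disjoint (A i) (B j) := fun i j hj =>
    hJ i j ((Finset.le_sup (Finset.mem_univ i)).trans hj)
  let cnt : (ℕ → Config S) → Fin l → ℕ := fun ω i =>
    ∑ j ∈ Finset.range (Finset.univ.sup J), (ω j).count (A i ∩ B j)
  have hcnt : Measurable cnt := measurable_pi_lambda _ fun i =>
    Finset.measurable_fun_sum _ fun j _ =>
      (Config.measurable_count ((hA i).inter (hBm j))).comp (measurable_pi_apply j)
  have hpre : Φ ⁻¹' countEvent A x = cnt ⁻¹' {x} := by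
    ext ω
    simp only [Set.mem_preimage, countEvent, Set.mem_ofPred_eq, Set.mem_singleton_iff, funext_iff]
    refine forall_congr' fun i => ?_
    rw [show (Φ ω).toMeasure (A i) = (cnt ω i : ℝ≥0∞) from
      superposition_apply hBm ω (hA i) (hJ' i), Nat.cast_inj]
  have hx : MeasurableSet (cnt ⁻¹' {x}) := hcnt (measurableSet_singleton x)
  have hκx : ∀ t, κ t (cnt ⁻¹' {x}) =
      ∏ i, ProbabilityTheory.poissonMeasure (t.toNNReal * (μ (A i)).toNNReal) {x i} := by
    intro t
    rw [← Measure.map_apply hcnt (measurableSet_singleton x),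
      map_count_poissonFamily hBm hBd hBu _ hA hAd hJ', ← Set.univ_pi_singleton, Measure.pi_pi]
  change (Q₀.map Φ).real (countEvent A x) = _
  rw [Measure.real, Measure.map_apply hΦ (measurableSet_countEvent hA hAb x), hpre,
    Measure.bind_apply hx hκ.aemeasurable]
  simp_rw [hκx]
  rw [lintegral_gammaMeasure_poisson ha hc, ENNReal.toReal_ofReal]
  · rfl
  · exact negBinomialMass_nonneg ha hc (fun _ => NNReal.coe_nonneg _) x

end Existence

end WaringProcess

theorem theorem13 {S : Type*} [MetricSpace S] [CompleteSpace S]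
    [TopologicalSpace.SeparableSpace S] [MeasurableSpace S] [BorelSpace S]
    (μ : Measure S) (hμ : WaringProcess.BoundedlyFinite μ)
    (a c : ℝ) (ha : 0 < a) (hc : 0 < c)
    (k : ℕ → ℝ) (hk : ∀ n, 0 < k n) (hk_lim : Tendsto k atTop atTop)
    (Ω : ℕ → Type*) [∀ n, MeasurableSpace (Ω n)]
    (P : ∀ n, Measure (Ω n)) [∀ n, IsProbabilityMeasure (P n)]
    (N : ∀ n, Ω n → WaringProcess.CountingMeasure S)
    (hN : ∀ n, WaringProcess.IsGeneralizedWaringProcess (P n) (N n) a (c * k n) (k n) μ) :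
    (∃ Q : ProbabilityMeasure (WaringProcess.CountingMeasure S),
      WaringProcess.IsNegativeBinomialProcess (Q : Measure (WaringProcess.CountingMeasure S)) id
        a c μ) ∧
    ∀ (Ω' : Type*) [MeasurableSpace Ω'] (P' : Measure Ω') [IsProbabilityMeasure P']
      (Z : Ω' → WaringProcess.CountingMeasure S),
      WaringProcess.IsNegativeBinomialProcess P' Z a c μ →
        TendstoInDistribution N atTop Z P P' := by
  refine ⟨WaringProcess.exists_isNegativeBinomialProcess hμ ha hc, fun Ω' _ P' _ Z hZ => ?_⟩
  refine ⟨fun n => (hN n).1.aemeasurable, hZ.1.aemeasurable, ?_⟩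
  refine WaringProcess.tendsto_of_tendsto_countEvent fun l A hA hAb hAd x => ?_
  have hE := WaringProcess.measurableSet_countEvent hA hAb x
  have hlim := (WaringProcess.tendsto_waringMass ha hc
    (m := fun i => μ.real (A i)) (fun _ => measureReal_nonneg) x).comp hk_lim
  have hPn : ∀ n, (P n).map (N n) (WaringProcess.countEvent A x) = ENNReal.ofReal
      (WaringProcess.waringMass a (fun i => k n * μ.real (A i)) (c * k n) x) := fun n => by
    rw [Measure.map_apply (hN n).1 hE, ← ofReal_measureReal]
    exact congrArg ENNReal.ofReal ((hN n).2 l A hA hAb hAd x)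
  have hP' : P'.map Z (WaringProcess.countEvent A x) = ENNReal.ofReal
      (WaringProcess.negBinomialMass a c (fun i => μ.real (A i)) x) := by
    rw [Measure.map_apply hZ.1 hE, ← ofReal_measureReal]
    exact congrArg ENNReal.ofReal (hZ.2 l A hA hAb hAd x)
  change Tendsto (fun n => (P n).map (N n) _) atTop (𝓝 (P'.map Z _))
  simp_rw [hPn, hP']
  exact ENNReal.tendsto_ofReal hlim
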